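/- Let $N\ge 1$, $n\ge 0$ be integers, let $\mathcal G$ be a connected undirected simple graph on the nodes $\{1,\dots,N\}$ with neighbourhoods $\mathcal N_i$ and Laplacian matrix $L$, and let $f_1,\dots,f_N:\mathbb R^n\to\mathbb R$ be convex and twice differentiable. Consider the distributed primal-dual dynamics $$\dot x^i=-\nabla f_i(x^i)-\sum_{j\in\mathcal N_i}(\nu^j-\nu^i),\qquad \dot\nu^i=\sum_{j\in\mathcal N_i}(x^j-x^i),\qquad i\in\{1,\dots,N\},$$ for $x^i,\nu^i\in\mathbb R^n$, and write $\mathbf x=(x^1,\dots,x^N)$, $\nu=(\nu^1,\dots,\nu^N)$. 1. The dynamics are weakly contractive with respect to the Euclidean norm $\|\cdot\|_2$ on $\mathbb R^{nN}\times\mathbb R^{nN}$: for every initial time $t_0\ge 0$ and every initial state there is a trajectory on $[t_0,\infty)$, and any two trajectories $z,w$ on $[t_0,\infty)$ satisfy $\|z(t)-w(t)\|_2\le\|z(t_0)-w(t_0)\|_2$ for all $t\ge t_0$ (so trajectories are unique). 2. Suppose that $x^*$ is a minimizer of $\sum_{i=1}^N f_i$ over $\mathbb R^n$ and that $\nabla^2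 f_i(x^*)\succ 0$ for every $i$. Then for every initial state $(x^i(0),\nu^i(0))_{i}$ and every $i$, $\lim_{t\to\infty}x^i(t)=x^*$ and $\lim_{t\to\infty}\nu^i(t)=\nu_i^*$ for some $\nu_1^*,\dots,\nu_N^*\in\mathbb R^n$ with $\sum_{k}\nu_k^*=\sum_k\nu^k(0)$; moreover $\sum_k\nu^k(t)=\sum_k\nu^k(0)$ for all $t\ge 0$. 3. Suppose that $x^*$ is a minimizer of $\sum_{i=1}^N f_i$ over $\mathbb R^n$ and that for every $i$ there are constants $\ell_{\inf,i}>0$ and $\ell_{\sup,i}>0$ with $$\ell_{\inf,i}\|x-y\|_2^2\le(\nabla f_i(x)-\nabla f_i(y))^\top(x-y),\qquad \|\nabla f_i(x)-\nabla f_i(y)\|_2\le\ell_{\sup,i}\|x-y\|_2\qquad(x,y\in\mathbb R^n).$$ Then the conclusions of part 2 hold. If moreover $N\ge 2$, let $\lambda_2$ and $\lambda_N$ be the smallest non-zero and the largest eigenvalue of $L$, let $\|\ell_{\sup}\|_\infty=\max_i\ell_{\sup,i}$, and for $0<\epsilon<1$ put $$c_\epsilon=\frac{3\epsilon}{4}\,\frac{\lambda_N\lambda_2^2}{\lambda_N+1}\,\frac{\min_{i}\ell_{\inf,i}}{\lambda_N^2+\frac34\lambda_N\lambda_2^2+\|\ell_{\sup}\|_\infty^2}.$$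 Then the convergence of $(\mathbf x(t),\nu(t))$ has exponential rate $c_\epsilon$: for every $\epsilon\in(0,1)$ there is a constant $C>0$ such that every trajectory converges to a limit $z^*=(x^*,\dots,x^*,\nu_1^*,\dots,\nu_N^*)$ with $\sum_k\nu_k^*=\sum_k\nu^k(0)$ and satisfies, for all $t\ge 0$, $$\|(\mathbf x(t),\nu(t))-z^*\|_2\le C\,e^{-c_\epsilon t}\,\|(\mathbf x(0),\nu(0))-z^*\|_2 .$$ -/

import Mathlib

open scoped Gradient RealInnerProductSpace

/-- `f` is twice differentiable on the whole space: `f` and its gradient map are differentiable. -/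
def TwiceDifferentiable {n : ℕ} (f : EuclideanSpace ℝ (Fin n) → ℝ) : Prop :=
  Differentiable ℝ f ∧ Differentiable ℝ (gradient f)

/-- The Hessian of `f` at `x`, as the derivative of the gradient map. -/
noncomputable def hessian {n : ℕ} (f : EuclideanSpace ℝ (Fin n) → ℝ)
    (x : EuclideanSpace ℝ (Fin n)) : EuclideanSpace ℝ (Fin n) →L[ℝ] EuclideanSpace ℝ (Fin n) :=
  fderiv ℝ (gradient f) x

/-- The Hessian of `f` at `x` is positive definite. -/
def HessianPosDef {n : ℕ} (f : EuclideanSpace ℝ (Fin n) → ℝ)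
    (x : EuclideanSpace ℝ (Fin n)) : Prop :=
  ∀ v : EuclideanSpace ℝ (Fin n), v ≠ 0 → 0 < ⟪v, hessian f x v⟫

/-- A (differentiable) function `f` is strongly convex with constant `K > 0`. -/
def StronglyConvexWithConst {n : ℕ} (K : ℝ) (f : EuclideanSpace ℝ (Fin n) → ℝ) : Prop :=
  0 < K ∧ ∀ x y : EuclideanSpace ℝ (Fin n),
    K * ‖x - y‖ ^ 2 ≤ ⟪gradient f x - gradient f y, x - y⟫

/-- A (differentiable) function `f` is Lipschitz smooth with constant `K > 0`. -/
def LipschitzSmoothWithConst {n : ℕ} (K : ℝ) (f : EuclideanSpace ℝ (Fin n) → ℝ) : Prop :=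
  0 < K ∧ ∀ x y : EuclideanSpace ℝ (Fin n), ‖gradient f x - gradient f y‖ ≤ K * ‖x - y‖

/-- `z` solves `ż = F z` on `[t₀, ∞)` (with the one-sided derivative at `t₀`). Values of `z` before
`t₀` are irrelevant. -/
def IsTrajectory {E : Type*} [NormedAddCommGroup E] [NormedSpace ℝ E]
    (F : E → E) (t₀ : ℝ) (z : ℝ → E) : Prop :=
  ∀ t : ℝ, t₀ ≤ t → HasDerivWithinAt z (F (z t)) (Set.Ici t₀) t

/-- The system `ż = F z` has a trajectory on `[t₀, ∞)` from every initial state at every initial time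
`t₀ ≥ 0`, and any two trajectories satisfy `‖z t - w t‖ ≤ ‖z t₀ - w t₀‖ exp (-c (t - t₀))`,
in the norm of the state space. (For equal initial states this gives uniqueness.) -/
def HasContractionRate {E : Type*} [NormedAddCommGroup E] [NormedSpace ℝ E]
    (F : E → E) (c : ℝ) : Prop :=
  (∀ t₀ : ℝ, 0 ≤ t₀ → ∀ z₀ : E, ∃ z : ℝ → E, IsTrajectory F t₀ z ∧ z t₀ = z₀) ∧
  ∀ t₀ : ℝ, 0 ≤ t₀ → ∀ z w : ℝ → E, IsTrajectory F t₀ z → IsTrajectory F t₀ w →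
    ∀ t : ℝ, t₀ ≤ t → ‖z t - w t‖ ≤ ‖z t₀ - w t₀‖ * Real.exp (-c * (t - t₀))

/-- Weak contractivity: the contraction estimate with `c = 0`. -/
def WeaklyContractive {E : Type*} [NormedAddCommGroup E] [NormedSpace ℝ E] (F : E → E) : Prop :=
  HasContractionRate F 0

/-- Stacked vectors `(y¹, …, yᴺ)` with `yⁱ ∈ ℝⁿ`, with the `ℓ₂`-norm of `ℝ^(nN)`. -/
abbrev AgentVec (N n : ℕ) : Type := PiLp 2 (fun _ : Fin N => EuclideanSpace ℝ (Fin n))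

/-- Primal-dual states `(𝐱, ν)`, with the `ℓ₂`-norm of `ℝ^(nN) × ℝ^(nN)`. -/
abbrev PDState (N n : ℕ) : Type := WithLp 2 (AgentVec N n × AgentVec N n)

/-- The state with primal blocks `x i` and dual blocks `ν i`. -/
def mkPDState {N n : ℕ} (x ν : Fin N → EuclideanSpace ℝ (Fin n)) : PDState N n :=
  WithLp.toLp 2 (WithLp.toLp 2 x, WithLp.toLp 2 ν)

/-- The vector field of the distributed primal-dual dynamics
`ẋⁱ = -∇fᵢ(xⁱ) - ∑_{j ∈ 𝒩ᵢ} (νʲ - νⁱ)`, `ν̇ⁱ = ∑_{j ∈ 𝒩ᵢ} (xʲ - xⁱ)`. -/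
noncomputable def distributedPD {N n : ℕ} (G : SimpleGraph (Fin N)) [DecidableRel G.Adj]
    (f : Fin N → EuclideanSpace ℝ (Fin n) → ℝ) (z : PDState N n) : PDState N n :=
  mkPDState
    (fun i => -gradient (f i) (z.fst i) - ∑ j ∈ G.neighborFinset i, (z.snd j - z.snd i))
    (fun i => ∑ j ∈ G.neighborFinset i, (z.fst j - z.fst i))

/-- `μ` is an eigenvalue of the Laplacian matrix of `G`. -/
def IsLaplacianEigenvalue {N : ℕ} (G : SimpleGraph (Fin N)) [DecidableRel G.Adj] (μ : ℝ) : Prop :=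
  Module.End.HasEigenvalue (Matrix.toLin' (G.lapMatrix ℝ)) μ

/-- Along every trajectory started at time `0`, every `xⁱ(t)` tends to `xstar`, the sum of the
`νⁱ(t)` is constant in time, and every `νⁱ(t)` tends to some limit `νᵢ*`, where
`∑ₖ νₖ* = ∑ₖ νᵏ(0)`. -/
def PDConverges {N n : ℕ} (G : SimpleGraph (Fin N)) [DecidableRel G.Adj]
    (f : Fin N → EuclideanSpace ℝ (Fin n) → ℝ) (xstar : EuclideanSpace ℝ (Fin n)) : Prop :=
  ∀ z : ℝ → PDState N n, IsTrajectory (distributedPD G f) 0 z →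
    (∀ i, Filter.Tendsto (fun t => (z t).fst i) Filter.atTop (nhds xstar)) ∧
    (∀ t : ℝ, 0 ≤ t → ∑ k, (z t).snd k = ∑ k, (z 0).snd k) ∧
    ∃ νstar : Fin N → EuclideanSpace ℝ (Fin n),
      (∀ i, Filter.Tendsto (fun t => (z t).snd i) Filter.atTop (nhds (νstar i))) ∧
      ∑ k, νstar k = ∑ k, (z 0).snd k

/-- Convergence with exponential rate `c`: there is an overshoot constant `C`, the same for all
trajectories, such that every trajectory `z` started at time `0` has a limit of the form
`(xstar, …, xstar, ν₁*, …, ν_N*)` with `∑ₖ νₖ* = ∑ₖ νᵏ(0)` whose distance from `z t` is at most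
`C exp (-c t)` times its distance from `z 0`. -/
def PDConvergesWithRate {N n : ℕ} (G : SimpleGraph (Fin N)) [DecidableRel G.Adj]
    (f : Fin N → EuclideanSpace ℝ (Fin n) → ℝ) (xstar : EuclideanSpace ℝ (Fin n))
    (c : ℝ) : Prop :=
  ∃ C : ℝ, 0 < C ∧ ∀ z : ℝ → PDState N n, IsTrajectory (distributedPD G f) 0 z →
    ∃ νstar : Fin N → EuclideanSpace ℝ (Fin n),
      ∑ k, νstar k = ∑ k, (z 0).snd k ∧
      Filter.Tendsto z Filter.atTop (nhds (mkPDState (fun _ => xstar) νstar)) ∧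
      ∀ t : ℝ, 0 ≤ t → ‖z t - mkPDState (fun _ => xstar) νstar‖ ≤
        C * Real.exp (-c * t) * ‖z 0 - mkPDState (fun _ => xstar) νstar‖

/-! With `T` the block Laplacian and `g` the stacked gradient, the dynamics read `ẋ = -g x + T ν`,
`ν̇ = -T x`. Since `T` is symmetric the coupling is skew, so the difference of two velocities paired
with the difference of the states leaves only `-⟪g x - g y, x - y⟫`, which convexity makes
nonpositive: distances between trajectories never grow. Existence needs an argument of its own,
because `g` is only known to be continuous and monotone. Smooth approximations of the field are
solved instead, and dissipativity makes their solutions a Cauchy family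
(`exists_solution_Icc_of_dissipative`).

For convergence, connectedness makes `ker T` the consensus vectors and `(ker T)ᗮ` the vectors of
zero block sum. At a minimizer the gradients sum to zero, so the stacked gradient lies in `range T =
(ker T)ᗮ` and a dual equilibrium exists; its sum can be chosen to match the conserved sum of the
`νⁱ`, which keeps the dual error in `(ker T)ᗮ`. The squared distance to this equilibrium decreases,
so by Barbalat's lemma its derivative tends to zero, and strict monotonicity of `g` at the consensus
point forces `x` to converge. Barbalat applied to `x` gives `ẋ → 0`, hence `T (ν - ν') → 0`, and `T`
is bounded below on `(ker T)ᗮ` (`IsTrajectory.tendsto_saddle`).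

The distance alone shows no decay in the dual direction. Subtracting a small multiple of the cross
term `⟪x - x', T (ν - ν')⟫` produces a `-‖T (ν - ν')‖²` in the derivative, and the spectral bounds
on `T` then give the rate (`saddle_lyapunov_deriv_le`). -/

open Set Filter Topology

/-! ### Existence and contraction for continuous dissipative vector fields. -/

section DissipativeFlow

variable {E : Type*} [NormedAddCommGroup E] [InnerProductSpace ℝ E]

/-- A curve whose velocity satisfies `⟪u, u'⟫ ≤ M ‖u‖` grows at most linearly in norm. -/
theorem norm_le_add_mul_of_inner_deriv_le {u u' : ℝ → E} {s : Set ℝ} (hs : s.OrdConnected)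
    {a b M : ℝ} (ha : a ∈ s) (hb : b ∈ s) (hab : a ≤ b)
    (hu : ∀ t ∈ s, HasDerivWithinAt u (u' t) s t)
    (hM : ∀ t ∈ s, ⟪u t, u' t⟫ ≤ M * ‖u t‖) (hM0 : 0 ≤ M) :
    ‖u b‖ ≤ ‖u a‖ + M * (b - a) := by
  -- The norm is not differentiable at `0`, so `√(‖u‖² + δ²)` replaces it and `δ` is then arbitrary.
  refine le_of_forall_pos_le_add fun δ hδ => ?_
  have hpos : ∀ t, 0 < ‖u t‖ ^ 2 + δ ^ 2 := fun t => by positivity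
  have hsub : Icc a b ⊆ s := hs.out ha hb
  have hder : ∀ t ∈ s, HasDerivWithinAt (fun t => Real.sqrt (‖u t‖ ^ 2 + δ ^ 2))
      (2 * ⟪u t, u' t⟫ / (2 * Real.sqrt (‖u t‖ ^ 2 + δ ^ 2))) s t := fun t ht =>
    (((hu t ht).norm_sq).add_const (δ ^ 2)).sqrt (hpos t).ne'
  have hle : ∀ t ∈ s, 2 * ⟪u t, u' t⟫ / (2 * Real.sqrt (‖u t‖ ^ 2 + δ ^ 2)) ≤ M := by
    intro t ht
    have h1 : ‖u t‖ ≤ Real.sqrt (‖u t‖ ^ 2 + δ ^ 2) :=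
      Real.le_sqrt_of_sq_le (by nlinarith [sq_nonneg δ])
    have h2 := Real.sqrt_pos.2 (hpos t)
    rw [div_le_iff₀ (by positivity)]
    nlinarith [hM t ht, mul_le_mul_of_nonneg_left h1 hM0]
  have key : Real.sqrt (‖u b‖ ^ 2 + δ ^ 2) - M * b ≤ Real.sqrt (‖u a‖ ^ 2 + δ ^ 2) - M * a := by
    have hanti : AntitoneOn (fun t => Real.sqrt (‖u t‖ ^ 2 + δ ^ 2) - M * t) (Icc a b) := by
      refine antitoneOn_of_hasDerivWithinAt_nonpos (convex_Icc a b)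
        (f' := fun t => 2 * ⟪u t, u' t⟫ / (2 * Real.sqrt (‖u t‖ ^ 2 + δ ^ 2)) - M) ?_ ?_ ?_
      · intro t ht
        exact (((hder t (hsub ht)).continuousWithinAt).mono hsub).sub (by fun_prop)
      · intro t ht
        have h := ((hder t (hsub (interior_subset ht))).mono (interior_subset.trans hsub)).sub
          ((hasDerivAt_id t).const_mul M).hasDerivWithinAt
        rw [mul_one] at h
        exact h
      · intro t ht
        exact sub_nonpos.2 (hle t (hsub (interior_subset ht)))
    exact hanti (left_mem_Icc.2 hab) (right_mem_Icc.2 hab) hab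
  have h1 : ‖u b‖ ≤ Real.sqrt (‖u b‖ ^ 2 + δ ^ 2) :=
    Real.le_sqrt_of_sq_le (by nlinarith [sq_nonneg δ])
  have h2 : Real.sqrt (‖u a‖ ^ 2 + δ ^ 2) ≤ ‖u a‖ + δ :=
    (Real.sqrt_le_left (by positivity)).2 (by nlinarith [norm_nonneg (u a)])
  linarith

theorem IsTrajectory.dist_le {F : E → E} (hmono : ∀ x y, ⟪x - y, F x - F y⟫ ≤ 0) {t₀ : ℝ}
    {z w : ℝ → E} (hz : IsTrajectory F t₀ z) (hw : IsTrajectory F t₀ w) {t : ℝ} (ht : t₀ ≤ t) :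
    ‖z t - w t‖ ≤ ‖z t₀ - w t₀‖ := by
  have := norm_le_add_mul_of_inner_deriv_le (u := fun t => z t - w t)
    (u' := fun t => F (z t) - F (w t)) (s := Ici t₀) ordConnected_Ici (M := 0) self_mem_Ici ht ht
    (fun s hs => (hz s hs).sub (hw s hs)) (fun s _ => by simpa using hmono (z s) (w s)) le_rfl
  simpa using this

variable [FiniteDimensional ℝ E]

/-- Speed at most `B` confines the solution to the ball of radius `B * T`, on which a `C¹` field is
Lipschitz; Picard–Lindelöf then covers all of `[0, T]` at once. -/
theorem exists_solution_Icc_of_contDiff {H : E → E} (hH : ContDiff ℝ 1 H) {B : ℝ}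
    (hB : ∀ x, ‖H x‖ ≤ B) (x₀ : E) {T : ℝ} (hT : 0 ≤ T) :
    ∃ z : ℝ → E, z 0 = x₀ ∧ ∀ t ∈ Icc 0 T, HasDerivWithinAt z (H (z t)) (Icc 0 T) t := by
  have hB0 : 0 ≤ B := (norm_nonneg _).trans (hB x₀)
  obtain ⟨K, hK⟩ := hH.contDiffOn.exists_lipschitzOnWith one_ne_zero
    (convex_closedBall x₀ (B * T)) (isCompact_closedBall x₀ (B * T))
  have hPL : IsPicardLindelof (fun _ => H) (⟨0, left_mem_Icc.2 hT⟩ : Icc (0 : ℝ) T) x₀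
      ⟨B * T, mul_nonneg hB0 hT⟩ 0 ⟨B, hB0⟩ K :=
    { lipschitzOnWith := fun _ _ => hK
      continuousOn := fun _ _ => continuousOn_const
      norm_le := fun _ _ x _ => hB x
      mul_max_le := by
        simp only [sub_zero, sub_self, max_eq_left hT, NNReal.coe_zero]
        exact le_rfl }
  exact hPL.exists_eq_forall_mem_Icc_hasDerivWithinAt₀

/-- Approximate solutions of `ż = F z` solving nearby smooth equations, in a ball that does not
depend on the quality of the approximation. -/
theorem exists_approx_solution_Icc {F : E → E} (hF : Continuous F)
    (hmono : ∀ x y, ⟪x - y, F x - F y⟫ ≤ 0) (x₀ : E) {T : ℝ} (hT : 0 ≤ T) :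
    ∃ R : ℝ, ∀ ε : ℝ, 0 < ε → ε ≤ 1 → ∃ (H : E → E) (z : ℝ → E), Continuous H ∧ z 0 = x₀ ∧
      (∀ t ∈ Icc 0 T, HasDerivWithinAt z (H (z t)) (Icc 0 T) t) ∧
      ∀ t ∈ Icc 0 T, ‖z t - x₀‖ ≤ R ∧ ‖H (z t) - F (z t)‖ ≤ ε := by
  -- By dissipativity the outward speed from `x₀` is at most `‖F x₀‖` plus the approximation error,
  -- and a cutoff with values in `[0, 1]` preserves this. The final `+ 1` keeps the radius positive
  -- when `T = 0`.
  set R : ℝ := (‖F x₀‖ + 1) * T + 1 with hR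
  have hR0 : 0 < R := by positivity
  refine ⟨R, fun ε hε hε1 => ?_⟩
  let χ : ContDiffBump x₀ := ⟨R, R + 1, hR0, by linarith⟩
  -- Compact support gives uniform continuity, hence a uniform smooth approximation, and a global
  -- bound.
  have hsupp : HasCompactSupport (fun x => χ x • F x) := χ.hasCompactSupport.smul_right
  have hcont : Continuous (fun x => χ x • F x) := χ.continuous.smul hF
  obtain ⟨H, hHs, hH⟩ := (hsupp.uniformContinuous_of_continuous hcont
    ).exists_contDiff_dist_le hε
  obtain ⟨B, hB⟩ := hsupp.exists_bound_of_continuous hcont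
  have hHb : ∀ x, ‖H x‖ ≤ B + ε := fun x => by
    have h1 := (hH x).le
    rw [dist_eq_norm] at h1
    have h2 := norm_add_le (H x - χ x • F x) (χ x • F x)
    rw [sub_add_cancel] at h2
    linarith [hB x]
  obtain ⟨z, hz0, hz⟩ := exists_solution_Icc_of_contDiff (hHs.of_le (by exact_mod_cast le_top))
    hHb x₀ hT
  have hbound : ∀ t ∈ Icc 0 T, ‖z t - x₀‖ ≤ R := by
    intro t ht
    have := norm_le_add_mul_of_inner_deriv_le (u := fun t => z t - x₀) (u' := fun t => H (z t))
      (s := Icc 0 T) ordConnected_Icc (M := ‖F x₀‖ + 1) (left_mem_Icc.2 hT) ht ht.1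
      (fun s hs => (hz s hs).sub_const x₀) (fun s hs => ?_) (by positivity)
    · simp only [hz0, sub_self, norm_zero, zero_add, sub_zero] at this
      have h3 : (‖F x₀‖ + 1) * t ≤ (‖F x₀‖ + 1) * T := by gcongr; exact ht.2
      linarith
    · have h1 : ⟪z s - x₀, H (z s) - χ (z s) • F (z s)⟫ ≤ ‖z s - x₀‖ * 1 :=
        (real_inner_le_norm _ _).trans (by
          gcongr
          rw [← dist_eq_norm]; exact (hH _).le.trans hε1)
      have h2 : ⟪z s - x₀, F (z s)⟫ ≤ ‖z s - x₀‖ * ‖F x₀‖ := by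
        have := hmono (z s) x₀
        rw [inner_sub_right] at this
        linarith [real_inner_le_norm (z s - x₀) (F x₀)]
      have h3 : χ (z s) * ⟪z s - x₀, F (z s)⟫ ≤ ‖z s - x₀‖ * ‖F x₀‖ := by
        have h4 : 0 ≤ χ (z s) := χ.nonneg
        have h5 : χ (z s) ≤ 1 := χ.le_one
        have h6 : 0 ≤ ‖z s - x₀‖ * ‖F x₀‖ := by positivity
        nlinarith
      rw [inner_sub_right, real_inner_smul_right] at h1
      linarith
  refine ⟨H, z, hHs.continuous, hz0, hz, fun t ht => ⟨hbound t ht, ?_⟩⟩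
  have h1 : χ (z t) = 1 := χ.one_of_mem_closedBall (by
    rw [Metric.mem_closedBall, dist_eq_norm]; exact hbound t ht)
  have h2 := (hH (z t)).le
  rwa [h1, one_smul, dist_eq_norm] at h2

/-- A continuous dissipative vector field on a finite-dimensional space has solutions on every
compact time interval. -/
theorem exists_solution_Icc_of_dissipative {F : E → E} (hF : Continuous F)
    (hmono : ∀ x y, ⟪x - y, F x - F y⟫ ≤ 0) (x₀ : E) {T : ℝ} (hT : 0 ≤ T) :
    ∃ z : ℝ → E, z 0 = x₀ ∧ ∀ t ∈ Icc 0 T, HasDerivWithinAt z (F (z t)) (Icc 0 T) t := by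
  obtain ⟨R, hR⟩ := exists_approx_solution_Icc hF hmono x₀ hT
  let ε : ℕ → ℝ := fun k => 1 / ((k : ℝ) + 1)
  have hε0 : ∀ k, 0 < ε k := fun k => Nat.one_div_pos_of_nat
  have hε1 : ∀ k, ε k ≤ 1 := fun k => by
    simp only [ε]
    rw [div_le_one (by positivity)]
    linarith [(Nat.cast_nonneg k : (0 : ℝ) ≤ k)]
  have hεlim : Tendsto ε atTop (𝓝 0) := tendsto_one_div_add_atTop_nhds_zero_nat
  choose H z hHc hz0 hz hzb using fun k => hR (ε k) (hε0 k) (hε1 k)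
  have hclose : ∀ k l, ∀ t ∈ Icc 0 T, ‖z k t - z l t‖ ≤ (ε k + ε l) * T := by
    intro k l t ht
    have := norm_le_add_mul_of_inner_deriv_le (u := fun t => z k t - z l t)
      (u' := fun t => H k (z k t) - H l (z l t))
      (s := Icc 0 T) ordConnected_Icc (M := ε k + ε l) (left_mem_Icc.2 hT) ht ht.1
      (fun s hs => (hz k s hs).sub (hz l s hs)) (fun s hs => ?_)
      (add_nonneg (hε0 k).le (hε0 l).le)
    · simp only [hz0, sub_self, norm_zero, zero_add, sub_zero] at this
      refine this.trans ?_
      have := (hε0 k).le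
      have := (hε0 l).le
      gcongr
      exact ht.2
    · have h1 := (real_inner_le_norm (z k s - z l s) (H k (z k s) - F (z k s))).trans
        (mul_le_mul_of_nonneg_left (hzb k s hs).2 (norm_nonneg _))
      have h2 := (neg_le_of_abs_le (abs_real_inner_le_norm (z k s - z l s)
        (H l (z l s) - F (z l s))))
      have h2' := mul_le_mul_of_nonneg_left (hzb l s hs).2 (norm_nonneg (z k s - z l s))
      have h3 := hmono (z k s) (z l s)
      -- The `F` difference contributes nothing positive, so only the two approximation errors can
      -- drive the solutions apart.
      have h4 : ⟪z k s - z l s, H k (z k s) - H l (z l s)⟫ =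
          ⟪z k s - z l s, H k (z k s) - F (z k s)⟫ - ⟪z k s - z l s, H l (z l s) - F (z l s)⟫
            + ⟪z k s - z l s, F (z k s) - F (z l s)⟫ := by
        simp only [inner_sub_right]; ring
      rw [h4]
      linarith
  have hlim : ∀ t, ∃ y, t ∈ Icc 0 T → Tendsto (fun k => z k t) atTop (𝓝 y) := by
    intro t
    by_cases ht : t ∈ Icc 0 T
    · have hc : CauchySeq (fun k => z k t) := by
        refine cauchySeq_of_le_tendsto_0 (fun k => 2 * ε k * T) (fun k l m hk hl => ?_) ?_
        · rw [dist_eq_norm]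
          refine (hclose k l t ht).trans ?_
          have h1 : ε k ≤ ε m := Nat.one_div_le_one_div hk
          have h2 : ε l ≤ ε m := Nat.one_div_le_one_div hl
          gcongr
          linarith
        · simpa using (hεlim.const_mul 2).mul_const T
      obtain ⟨y, hy⟩ := cauchySeq_tendsto_of_complete hc
      exact ⟨y, fun _ => hy⟩
    · exact ⟨0, fun h => absurd h ht⟩
  choose y hy using hlim
  have hyclose : ∀ k, ∀ t ∈ Icc 0 T, ‖z k t - y t‖ ≤ ε k * T := by
    intro k t ht
    have h1 : Tendsto (fun l => ‖z k t - z l t‖) atTop (𝓝 ‖z k t - y t‖) :=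
      (tendsto_const_nhds.sub (hy t ht)).norm
    have h2 : Tendsto (fun l => (ε k + ε l) * T) atTop (𝓝 ((ε k + 0) * T)) :=
      (tendsto_const_nhds.add hεlim).mul_const T
    simpa using le_of_tendsto_of_tendsto' h1 h2 fun l => hclose k l t ht
  have hyc : ContinuousOn y (Icc 0 T) := by
    have hunif : TendstoUniformlyOn z y atTop (Icc 0 T) := by
      rw [Metric.tendstoUniformlyOn_iff]
      intro δ hδ
      have h0 : Tendsto (fun k => ε k * T) atTop (𝓝 0) := by simpa using hεlim.mul_const T
      filter_upwards [h0.eventually_lt_const hδ] with k hk t ht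
      rw [dist_comm, dist_eq_norm]
      exact (hyclose k t ht).trans_lt hk
    exact hunif.continuousOn (Frequently.of_forall fun k t ht => (hz k t ht).continuousWithinAt)
  have hHlim : ∀ t ∈ Icc 0 T, Tendsto (fun k => H k (z k t)) atTop (𝓝 (F (y t))) := by
    intro t ht
    have h1 : Tendsto (fun k => H k (z k t) - F (z k t)) atTop (𝓝 0) :=
      squeeze_zero_norm (fun k => (hzb k t ht).2) hεlim
    have h2 := h1.add ((hF.tendsto (y t)).comp (hy t ht))
    simpa using h2
  obtain ⟨B, hB⟩ := (isCompact_closedBall x₀ R).exists_bound_of_continuousOn hF.continuousOn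
  -- Derivatives need not pass to the limit, but the integral equation does, by dominated
  -- convergence; differentiability of `y` is read off from it.
  have hint : ∀ t ∈ Icc 0 T, y t = ODE.picard (fun _ => F) 0 x₀ y t := by
    intro t ht
    have hsub : uIcc 0 t ⊆ Icc 0 T := by
      rw [uIcc_of_le ht.1]; exact Icc_subset_Icc_right ht.2
    have h1 : ∀ k, ODE.picard (fun _ => H k) 0 x₀ (z k) t = z k t := by
      intro k
      rw [← hz0 k]
      exact ODE.picard_eq_of_hasDerivAt (u := univ)
        (((hHc k).comp continuous_snd).continuousOn)
        (fun s hs => (hz k s (hsub hs)).mono hsub) (mapsTo_univ _ _)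
    have h2 : Tendsto (fun k => ODE.picard (fun _ => H k) 0 x₀ (z k) t) atTop
        (𝓝 (ODE.picard (fun _ => F) 0 x₀ y t)) := by
      refine tendsto_const_nhds.add ?_
      refine intervalIntegral.tendsto_integral_filter_of_dominated_convergence (fun _ => B + 1)
        (Eventually.of_forall fun k => ?_) (Eventually.of_forall fun k => ?_) (by simp) ?_
      · have hck : ContinuousOn (fun s => H k (z k s)) (uIcc 0 t) :=
          (hHc k).comp_continuousOn fun s hs =>
            ((hz k s (hsub hs)).continuousWithinAt).mono hsub
        exact (hck.mono uIoc_subset_uIcc).aestronglyMeasurable measurableSet_uIoc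
      · refine Eventually.of_forall fun s hs => ?_
        have hs' := hsub (uIoc_subset_uIcc hs)
        have h3 := norm_add_le (H k (z k s) - F (z k s)) (F (z k s))
        rw [sub_add_cancel] at h3
        have h4 := hB (z k s) (by
          rw [Metric.mem_closedBall, dist_eq_norm]; exact (hzb k s hs').1)
        linarith [(hzb k s hs').2, hε1 k]
      · exact Eventually.of_forall fun s hs => hHlim s (hsub (uIoc_subset_uIcc hs))
    simp only [h1] at h2
    exact tendsto_nhds_unique (hy t ht) h2
  refine ⟨y, ?_, fun t ht => ?_⟩
  · rw [hint 0 (left_mem_Icc.2 hT), ODE.picard_apply₀]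
  · exact (ODE.hasDerivWithinAt_picard_Icc (f := fun _ => F) (u := univ) (left_mem_Icc.2 hT)
      ((hF.comp continuous_snd).continuousOn) hyc (fun _ _ => mem_univ _) x₀ ht).congr
      hint (hint t ht)

theorem exists_isTrajectory_zero {F : E → E} (hF : Continuous F)
    (hmono : ∀ x y, ⟪x - y, F x - F y⟫ ≤ 0) (x₀ : E) :
    ∃ z : ℝ → E, IsTrajectory F 0 z ∧ z 0 = x₀ := by
  choose z hz0 hz using fun k : ℕ =>
    exists_solution_Icc_of_dissipative hF hmono x₀ (T := k) (Nat.cast_nonneg k)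
  have hagree : ∀ k l : ℕ, k ≤ l → ∀ t ∈ Icc (0 : ℝ) k, z k t = z l t := by
    intro k l hkl t ht
    have hsub : Icc (0 : ℝ) k ⊆ Icc 0 l := Icc_subset_Icc_right (by exact_mod_cast hkl)
    have := norm_le_add_mul_of_inner_deriv_le (u := fun t => z k t - z l t)
      (u' := fun t => F (z k t) - F (z l t)) (s := Icc (0 : ℝ) k) ordConnected_Icc (M := 0)
      (left_mem_Icc.2 (Nat.cast_nonneg k)) ht ht.1
      (fun s hs => (hz k s hs).sub ((hz l s (hsub hs)).mono hsub))
      (fun s _ => by simpa using hmono (z k s) (z l s)) le_rfl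
    simpa [hz0, sub_eq_zero] using this
  have hZ : ∀ k : ℕ, ∀ t ∈ Icc (0 : ℝ) k, z ⌈t⌉₊ t = z k t := fun k t ht =>
    hagree _ _ (Nat.ceil_le.2 ht.2) t ⟨ht.1, Nat.le_ceil t⟩
  refine ⟨fun t => z ⌈t⌉₊ t, fun t ht => ?_, by simp [hz0]⟩
  -- The extra `1` leaves room to the right of `t`, even when `t` is an integer.
  have ht' : t ∈ Icc (0 : ℝ) (⌈t⌉₊ + 1 : ℕ) :=
    ⟨ht, (Nat.le_ceil t).trans (by push_cast; linarith)⟩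
  have h1 : HasDerivWithinAt (fun t => z ⌈t⌉₊ t) (F (z ⌈t⌉₊ t)) (Icc (0 : ℝ) (⌈t⌉₊ + 1 : ℕ)) t := by
    rw [hZ _ t ht']
    exact (hz _ t ht').congr (hZ _) (hZ _ t ht')
  refine h1.mono_of_mem_nhdsWithin ?_
  rw [← Ici_inter_Iic]
  refine inter_mem self_mem_nhdsWithin (mem_nhdsWithin_of_mem_nhds (Iic_mem_nhds ?_))
  push_cast
  linarith [Nat.le_ceil t]

theorem weaklyContractive_of_dissipative {F : E → E} (hF : Continuous F)
    (hmono : ∀ x y, ⟪x - y, F x - F y⟫ ≤ 0) : WeaklyContractive F := by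
  refine ⟨fun t₀ _ z₀ => ?_, fun t₀ _ z w hz hw t ht => ?_⟩
  · obtain ⟨z, hz, hz0⟩ := exists_isTrajectory_zero hF hmono z₀
    refine ⟨fun t => z (t - t₀), fun t ht => ?_, by simpa using hz0⟩
    have h := (hz (t - t₀) (sub_nonneg.2 ht)).scomp t
      ((hasDerivAt_id t).sub_const t₀).hasDerivWithinAt (s := Ici t₀)
      (fun s hs => by simpa using hs)
    simpa [Function.comp_def] using h
  · simpa using hz.dist_le hmono hw ht

end DissipativeFlow

/-! ### Barbalat's lemma. -/

/-- **Barbalat's lemma**: if a curve converges and its velocity is uniformly continuous, then the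
velocity tends to zero. -/
theorem tendsto_deriv_zero_of_tendsto {E : Type*} [NormedAddCommGroup E] [NormedSpace ℝ E]
    {u v : ℝ → E} {a : ℝ} {l : E} (hu : ∀ t ∈ Ici a, HasDerivWithinAt u (v t) (Ici a) t)
    (hv : UniformContinuousOn v (Ici a)) (hl : Tendsto u atTop (𝓝 l)) :
    Tendsto v atTop (𝓝 0) := by
  rw [Metric.tendsto_nhds]
  intro ε hε
  obtain ⟨δ, hδ, hδv⟩ := Metric.uniformContinuousOn_iff.1 hv (ε / 2) (half_pos hε)
  set h := δ / 2 with hh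
  have hh0 : 0 < h := half_pos hδ
  have hshift : Tendsto (fun t => u (t + h) - u t) atTop (𝓝 0) := by
    simpa using (hl.comp (tendsto_atTop_add_const_right atTop h tendsto_id)).sub hl
  filter_upwards [(Metric.tendsto_nhds.1 hshift) (ε / 2 * h) (by positivity),
    eventually_ge_atTop a] with t ht hta
  rw [dist_zero_right] at ht ⊢
  -- On `[t, t + h]` the velocity stays within `ε / 2` of `v t`, so `h • v t` nearly equals the
  -- increment of `u`, which tends to zero.
  have hmv : ‖(u (t + h) - (t + h) • v t) - (u t - t • v t)‖ ≤ ε / 2 * ‖t + h - t‖ := by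
    refine (convex_Icc t (t + h)).norm_image_sub_le_of_norm_hasDerivWithin_le
      (f := fun s => u s - s • v t) (f' := fun s => v s - v t) (fun s hs => ?_) (fun s hs => ?_)
      (left_mem_Icc.2 (by linarith)) (right_mem_Icc.2 (by linarith))
    · have h1 := ((hu s (hta.trans hs.1)).mono
        (fun r hr => hta.trans hr.1 : Icc t (t + h) ⊆ Ici a)).sub
        ((hasDerivAt_id s).smul_const (v t)).hasDerivWithinAt
      rw [one_smul] at h1
      exact h1
    · have := hδv s (hta.trans hs.1) t hta (by
        rw [Real.dist_eq, abs_of_nonneg (by linarith [hs.1])]; linarith [hs.2])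
      rw [dist_eq_norm] at this
      exact this.le
  have heq : (u (t + h) - (t + h) • v t) - (u t - t • v t) = (u (t + h) - u t) - h • v t := by
    rw [add_smul]; abel
  rw [heq, add_sub_cancel_left, Real.norm_of_nonneg hh0.le] at hmv
  have h2 : ‖h • v t‖ ≤ ‖u (t + h) - u t‖ + ‖(u (t + h) - u t) - h • v t‖ := by
    have := norm_sub_le (u (t + h) - u t) ((u (t + h) - u t) - h • v t)
    rwa [sub_sub_cancel] at this
  rw [norm_smul, Real.norm_of_nonneg hh0.le] at h2
  have h3 : h * ‖v t‖ < h * ε := by linarith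
  exact lt_of_mul_lt_mul_left h3 hh0.le

/-! ### Monotonicity of gradients of convex functions. -/

section ConvexGradient

variable {E : Type*} [NormedAddCommGroup E] [InnerProductSpace ℝ E] [CompleteSpace E] {f : E → ℝ}

theorem hasDerivAt_comp_lineMap (hd : Differentiable ℝ f) (x y : E) (s : ℝ) :
    HasDerivAt (fun s : ℝ => f (AffineMap.lineMap x y s))
      ⟪gradient f (AffineMap.lineMap x y s), y - x⟫ s := by
  have h1 := (hd (AffineMap.lineMap x y s)).hasGradientAt.hasFDerivAt
  exact h1.comp_hasDerivAt s (AffineMap.hasDerivAt_lineMap (a := x) (b := y) (x := s))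

theorem ConvexOn.monotone_inner_gradient_lineMap (hf : ConvexOn ℝ univ f)
    (hd : Differentiable ℝ f) (x y : E) :
    Monotone fun s : ℝ => ⟪gradient f (AffineMap.lineMap x y s), y - x⟫ := by
  have hc : ConvexOn ℝ univ (fun s : ℝ => f (AffineMap.lineMap x y s)) := by
    simpa using! hf.comp_affineMap (AffineMap.lineMap x y)
  have h := hc.monotoneOn_deriv fun s _ => (hasDerivAt_comp_lineMap hd x y s).differentiableAt
  have heq : deriv (fun s : ℝ => f (AffineMap.lineMap x y s)) =
      fun s => ⟪gradient f (AffineMap.lineMap x y s), y - x⟫ :=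
    funext fun s => (hasDerivAt_comp_lineMap hd x y s).deriv
  rwa [heq, monotoneOn_univ] at h

theorem ConvexOn.inner_gradient_sub_nonneg (hf : ConvexOn ℝ univ f) (hd : Differentiable ℝ f)
    (x y : E) : 0 ≤ ⟪gradient f y - gradient f x, y - x⟫ := by
  have := hf.monotone_inner_gradient_lineMap hd x y zero_le_one
  simp only [AffineMap.lineMap_apply_zero, AffineMap.lineMap_apply_one] at this
  rw [inner_sub_left]
  linarith

/-- If the Hessian of a convex function is positive in the direction from `x` to `y`, then the
gradient is strictly monotone between `x` and `y`. -/
theorem ConvexOn.inner_gradient_sub_pos (hf : ConvexOn ℝ univ f) (hd : Differentiable ℝ f)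
    {x : E} (hg : DifferentiableAt ℝ (gradient f) x) {y : E}
    (hpos : 0 < ⟪y - x, fderiv ℝ (gradient f) x (y - x)⟫) :
    0 < ⟪gradient f y - gradient f x, y - x⟫ := by
  set φ : ℝ → ℝ := fun s => ⟪gradient f (AffineMap.lineMap x y s), y - x⟫ with hφ
  have hmono : Monotone φ := hf.monotone_inner_gradient_lineMap hd x y
  have hder : HasDerivAt φ ⟪fderiv ℝ (gradient f) x (y - x), y - x⟫ 0 := by
    have h1 : HasFDerivAt (gradient f) (fderiv ℝ (gradient f) x) (AffineMap.lineMap x y (0 : ℝ)) := by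
      simpa using hg.hasFDerivAt
    have h2 := h1.comp_hasDerivAt (0 : ℝ) (AffineMap.hasDerivAt_lineMap (a := x) (b := y) (x := 0))
    have h3 := h2.inner ℝ (hasDerivAt_const (0 : ℝ) (y - x))
    rw [inner_zero_right, zero_add] at h3
    exact h3
  rw [inner_sub_left]
  by_contra! hle
  have h0 : φ 0 = ⟪gradient f x, y - x⟫ := by simp [hφ]
  have h1 : φ 1 = ⟪gradient f y, y - x⟫ := by simp [hφ]
  -- A monotone function with `φ 1 ≤ φ 0` is constant on `[0, 1]`, which contradicts its positive
  -- derivative at `0`.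
  have hconst : ∀ s ∈ Icc (0 : ℝ) 1, φ s = φ 0 := fun s hs =>
    le_antisymm ((hmono hs.2).trans (by linarith)) (hmono hs.1)
  have hd1 : HasDerivWithinAt φ ⟪fderiv ℝ (gradient f) x (y - x), y - x⟫ (Icc 0 1) 0 :=
    hder.hasDerivWithinAt
  have hd2 : HasDerivWithinAt φ 0 (Icc 0 1) 0 :=
    (hasDerivWithinAt_const (0 : ℝ) _ (φ 0)).congr hconst rfl
  have := (uniqueDiffOn_Icc_zero_one 0 (by simp)).eq_deriv _ hd1 hd2
  rw [real_inner_comm] at hpos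
  exact hpos.ne' this

theorem sum_gradient_eq_zero_of_isMinOn {ι : Type*} [Fintype ι] {f : ι → E → ℝ}
    (hd : ∀ i, Differentiable ℝ (f i)) {x : E} (hx : IsMinOn (fun x => ∑ i, f i x) univ x) :
    ∑ i, gradient (f i) x = 0 := by
  have h1 : HasFDerivAt (fun x => ∑ i, f i x)
      (∑ i, InnerProductSpace.toDual ℝ E (gradient (f i) x)) x :=
    HasFDerivAt.fun_sum fun i _ => (hd i x).hasGradientAt.hasFDerivAt
  have h2 := (hx.isLocalMin univ_mem).hasFDerivAt_eq_zero h1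
  rw [← map_sum] at h2
  exact (LinearIsometryEquiv.map_eq_zero_iff _).1 h2

end ConvexGradient

/-! ### Spectral bounds for symmetric operators. -/

namespace LinearMap.IsSymmetric

variable {E : Type*} [NormedAddCommGroup E] [InnerProductSpace ℝ E] [FiniteDimensional ℝ E]
  {T : E →ₗ[ℝ] E}

theorem norm_apply_sq_eq_sum (hT : T.IsSymmetric) (x : E) :
    ‖T x‖ ^ 2 = ∑ i, hT.eigenvalues rfl i ^ 2 * ⟪hT.eigenvectorBasis rfl i, x⟫ ^ 2 := by
  rw [← (hT.eigenvectorBasis rfl).sum_sq_norm_inner_right]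
  refine Finset.sum_congr rfl fun i _ => ?_
  have := hT.eigenvectorBasis_apply_self_apply rfl x i
  rw [OrthonormalBasis.repr_apply_apply, OrthonormalBasis.repr_apply_apply] at this
  rw [this, Real.norm_eq_abs, sq_abs, mul_pow]
  rfl

theorem norm_sq_eq_sum (hT : T.IsSymmetric) (x : E) :
    ‖x‖ ^ 2 = ∑ i, ⟪hT.eigenvectorBasis rfl i, x⟫ ^ 2 := by
  rw [← (hT.eigenvectorBasis rfl).sum_sq_norm_inner_right]
  simp

theorem norm_apply_le (hT : T.IsSymmetric) {M : ℝ} (hM0 : 0 ≤ M)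
    (hM : ∀ μ, Module.End.HasEigenvalue T μ → |μ| ≤ M) (x : E) : ‖T x‖ ≤ M * ‖x‖ := by
  refine le_of_sq_le_sq ?_ (by positivity)
  rw [mul_pow, hT.norm_apply_sq_eq_sum, hT.norm_sq_eq_sum, Finset.mul_sum]
  refine Finset.sum_le_sum fun i _ => ?_
  have := sq_le_sq' (neg_le_of_abs_le (hM _ (hT.hasEigenvalue_eigenvalues rfl i)))
    (le_of_abs_le (hM _ (hT.hasEigenvalue_eigenvalues rfl i)))
  exact mul_le_mul_of_nonneg_right this (sq_nonneg _)

/-- In an eigenbasis, a vector orthogonal to the kernel has no coordinate along eigenvectors of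
eigenvalue zero. -/
theorem le_norm_apply_of_mem_ker_orthogonal (hT : T.IsSymmetric) {m : ℝ} (hm0 : 0 ≤ m)
    (hm : ∀ μ, μ ≠ 0 → Module.End.HasEigenvalue T μ → m ≤ |μ|) {x : E}
    (hx : x ∈ (LinearMap.ker T)ᗮ) : m * ‖x‖ ≤ ‖T x‖ := by
  refine le_of_sq_le_sq ?_ (by positivity)
  rw [mul_pow, hT.norm_apply_sq_eq_sum, hT.norm_sq_eq_sum, Finset.mul_sum]
  refine Finset.sum_le_sum fun i _ => ?_
  by_cases h0 : hT.eigenvalues rfl i = 0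
  · have hker : hT.eigenvectorBasis rfl i ∈ LinearMap.ker T := by
      rw [LinearMap.mem_ker, hT.apply_eigenvectorBasis, h0]
      simp
    rw [hx _ hker]
    simp
  · have := hm _ h0 (hT.hasEigenvalue_eigenvalues rfl i)
    have h2 : m ^ 2 ≤ hT.eigenvalues rfl i ^ 2 := by
      rw [← sq_abs (hT.eigenvalues rfl i)]
      gcongr
    gcongr

theorem exists_pos_le_norm_apply (hT : T.IsSymmetric) :
    ∃ m : ℝ, 0 < m ∧ ∀ x ∈ (LinearMap.ker T)ᗮ, m * ‖x‖ ≤ ‖T x‖ := by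
  obtain ⟨m, hm0, hm⟩ : ∃ m : ℝ, 0 < m ∧ ∀ i, hT.eigenvalues rfl i ≠ 0 →
      m ≤ |hT.eigenvalues rfl i| := by
    rcases (Finset.univ.filter fun i => hT.eigenvalues rfl i ≠ 0).eq_empty_or_nonempty with h | h
    · exact ⟨1, one_pos, fun i hi => by
        have : i ∈ Finset.univ.filter fun i => hT.eigenvalues rfl i ≠ 0 := by simp [hi]
        simp [h] at this⟩
    · obtain ⟨j, hj, hmin⟩ := Finset.exists_min_image _ (fun i => |hT.eigenvalues rfl i|) h
      exact ⟨_, abs_pos.2 (Finset.mem_filter.1 hj).2, fun i hi => hmin i (by simp [hi])⟩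
  refine ⟨m, hm0, fun x hx => hT.le_norm_apply_of_mem_ker_orthogonal hm0.le (fun μ hμ hev => ?_) hx⟩
  obtain ⟨i, hi⟩ := hT.exists_eigenvalues_eq rfl hev
  have hi' : hT.eigenvalues rfl i = μ := by simpa using hi
  rw [← hi']
  exact hm i (hi' ▸ hμ)

theorem range_eq_ker_orthogonal (hT : T.IsSymmetric) :
    LinearMap.range T = (LinearMap.ker T)ᗮ := by
  rw [← hT.orthogonal_range, Submodule.orthogonal_orthogonal]

end LinearMap.IsSymmetric

/-! ### The Laplacian on stacked vectors. -/

section BlockLaplacian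

variable {N n : ℕ} (G : SimpleGraph (Fin N)) [DecidableRel G.Adj]

/-- The Laplacian `L ⊗ Iₙ` of the graph acting on stacked vectors. -/
noncomputable def blockLaplacian : AgentVec N n →ₗ[ℝ] AgentVec N n where
  toFun x := WithLp.toLp 2 fun i => ∑ j ∈ G.neighborFinset i, (x i - x j)
  map_add' x y := by
    ext i : 1
    simp only [PiLp.add_apply, ← Finset.sum_add_distrib]
    exact Finset.sum_congr rfl fun j _ => by abel
  map_smul' c x := by
    ext i : 1
    simp only [PiLp.smul_apply, RingHom.id_apply, Finset.smul_sum, smul_sub]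

theorem blockLaplacian_apply (x : AgentVec N n) (i : Fin N) :
    blockLaplacian G x i = ∑ j ∈ G.neighborFinset i, (x i - x j) := rfl

theorem blockLaplacian_apply_apply (x : AgentVec N n) (i : Fin N) (k : Fin n) :
    blockLaplacian G x i k = (G.lapMatrix ℝ).mulVec (fun i => x i k) i := by
  rw [SimpleGraph.lapMatrix_mulVec_apply, blockLaplacian_apply]
  simp

theorem isSymmetric_blockLaplacian : (blockLaplacian (n := n) G).IsSymmetric := by
  have key : ∀ x y : AgentVec N n, ⟪blockLaplacian G x, y⟫ = ∑ i, (∑ j, if G.Adj i j then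
      ⟪x i, y i⟫ else 0) - ∑ i, ∑ j, if G.Adj i j then ⟪x j, y i⟫ else 0 := by
    intro x y
    rw [PiLp.inner_apply, ← Finset.sum_sub_distrib]
    refine Finset.sum_congr rfl fun i _ => ?_
    rw [blockLaplacian_apply, sum_inner, SimpleGraph.neighborFinset_eq_filter, Finset.sum_filter,
      ← Finset.sum_sub_distrib]
    refine Finset.sum_congr rfl fun j _ => ?_
    split_ifs <;> simp [inner_sub_left]
  intro x y
  rw [real_inner_comm (blockLaplacian G y) x, key, key]
  congr 1
  · simp only [real_inner_comm]
  · rw [Finset.sum_comm]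
    refine Finset.sum_congr rfl fun i _ => Finset.sum_congr rfl fun j _ => ?_
    simp only [G.adj_comm i j, real_inner_comm]

variable {G} in
theorem blockLaplacian_eq_zero_iff (hG : G.Connected) {x : AgentVec N n} :
    blockLaplacian G x = 0 ↔ ∀ i j, x i = x j := by
  constructor
  · intro h i j
    ext k
    refine (G.lapMatrix_mulVec_eq_zero_iff_forall_reachable (x := fun i => x i k)).1 ?_ i j
      (hG.preconnected i j)
    ext l
    rw [← blockLaplacian_apply_apply, h]
    rfl
  · intro h
    ext i : 1
    rw [blockLaplacian_apply]
    exact Finset.sum_eq_zero fun j _ => by rw [h i j, sub_self]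

variable {G} in
theorem mem_ker_blockLaplacian_orthogonal_iff (hG : G.Connected) {v : AgentVec N n} :
    v ∈ (LinearMap.ker (blockLaplacian (n := n) G))ᗮ ↔ ∑ i, v i = 0 := by
  rw [Submodule.mem_orthogonal]
  constructor
  · intro h
    have hker : (WithLp.toLp 2 fun _ => ∑ i, v i : AgentVec N n) ∈
        LinearMap.ker (blockLaplacian (n := n) G) :=
      LinearMap.mem_ker.2 ((blockLaplacian_eq_zero_iff hG).2 fun _ _ => rfl)
    have h1 := h _ hker
    rw [PiLp.inner_apply, ← inner_sum] at h1
    exact inner_self_eq_zero.1 h1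
  · intro h u hu
    obtain ⟨i₀⟩ := hG.nonempty
    have hc := (blockLaplacian_eq_zero_iff hG).1 (LinearMap.mem_ker.1 hu)
    rw [PiLp.inner_apply, Finset.sum_congr rfl fun i _ => by rw [hc i i₀], ← inner_sum, h,
      inner_zero_right]

variable {G} in
-- The block Laplacian acts on each coordinate slice as the Laplacian matrix, and some slice of an
-- eigenvector is nonzero.
theorem isLaplacianEigenvalue_of_blockLaplacian {μ : ℝ}
    (h : Module.End.HasEigenvalue (blockLaplacian (n := n) G) μ) : IsLaplacianEigenvalue G μ := by
  obtain ⟨x, hx⟩ := h.exists_hasEigenvector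
  obtain ⟨k, hk⟩ : ∃ k, (fun i => x i k) ≠ 0 := by
    by_contra! hall
    exact hx.2 (by ext i k; exact congrFun (hall k) i)
  refine Module.End.hasEigenvalue_of_hasEigenvector (x := fun i => x i k)
    ⟨Module.End.mem_eigenspace_iff.2 ?_, hk⟩
  ext i
  rw [Matrix.toLin'_apply, ← blockLaplacian_apply_apply, hx.apply_eq_smul]
  rfl

variable {G} in
theorem IsLaplacianEigenvalue.nonneg {μ : ℝ} (h : IsLaplacianEigenvalue G μ) : 0 ≤ μ := by
  obtain ⟨x, hx⟩ := h.exists_hasEigenvector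
  have h1 := (SimpleGraph.posSemidef_lapMatrix ℝ G).dotProduct_mulVec_nonneg x
  rw [← Matrix.toLin'_apply, hx.apply_eq_smul, dotProduct_smul, smul_eq_mul] at h1
  have h2 : 0 < star x ⬝ᵥ x := Matrix.dotProduct_star_self_pos_iff.2 hx.2
  exact nonneg_of_mul_nonneg_left h1 h2

end BlockLaplacian

/-! ### Convergence of the abstract primal-dual flow. -/

section SaddleFlow

variable {E : Type*} [NormedAddCommGroup E] [InnerProductSpace ℝ E]

/-- The vector field of the primal-dual dynamics `ẋ = -g x + T ν`, `ν̇ = -T x`. -/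
noncomputable def saddleField (T : E →ₗ[ℝ] E) (g : E → E) (z : WithLp 2 (E × E)) :
    WithLp 2 (E × E) :=
  WithLp.toLp 2 (-g z.fst + T z.snd, -T z.fst)

variable {T : E →ₗ[ℝ] E} {g : E → E}

/-- The two coupling terms cancel by symmetry of `T`. -/
theorem inner_sub_saddleField_sub (hT : T.IsSymmetric) (z w : WithLp 2 (E × E)) :
    ⟪z - w, saddleField T g z - saddleField T g w⟫ = -⟪g z.fst - g w.fst, z.fst - w.fst⟫ := by
  have h1 : ⟪z - w, saddleField T g z - saddleField T g w⟫ =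
      ⟪z.fst - w.fst, (-g z.fst + T z.snd) - (-g w.fst + T w.snd)⟫ +
      ⟪z.snd - w.snd, -T z.fst - -T w.fst⟫ := rfl
  have h2 : (-g z.fst + T z.snd) - (-g w.fst + T w.snd) =
      T (z.snd - w.snd) - (g z.fst - g w.fst) := by rw [map_sub]; abel
  have h3 : -T z.fst - -T w.fst = -T (z.fst - w.fst) := by rw [map_sub]; abel
  rw [h1, h2, h3, inner_sub_right, inner_neg_right, ← hT, real_inner_comm (z.snd - w.snd),
    real_inner_comm (z.fst - w.fst) (g z.fst - g w.fst)]
  ring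

theorem saddleField_dissipative (hT : T.IsSymmetric)
    (hg : ∀ x y, 0 ≤ ⟪g x - g y, x - y⟫) (z w : WithLp 2 (E × E)) :
    ⟪z - w, saddleField T g z - saddleField T g w⟫ ≤ 0 := by
  rw [inner_sub_saddleField_sub hT]
  linarith [hg z.fst w.fst]

theorem continuous_saddleField [FiniteDimensional ℝ E] (hg : Continuous g) :
    Continuous (saddleField T g) := by
  have hTc : Continuous T := T.continuous_of_finiteDimensional
  have h1 : Continuous fun z : WithLp 2 (E × E) => z.fst := (WithLp.fstL 2 ℝ E E).continuous
  have h2 : Continuous fun z : WithLp 2 (E × E) => z.snd := (WithLp.sndL 2 ℝ E E).continuous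
  exact (WithLp.prod_continuous_toLp 2 E E).comp
    (((hg.comp h1).neg.add (hTc.comp h2)).prodMk (hTc.comp h1).neg)

section Trajectory

variable {z : ℝ → WithLp 2 (E × E)}

theorem IsTrajectory.hasDerivWithinAt_fst (hz : IsTrajectory (saddleField T g) 0 z) {t : ℝ}
    (ht : 0 ≤ t) :
    HasDerivWithinAt (fun t => (z t).fst) (-g (z t).fst + T (z t).snd) (Ici 0) t :=
  ((WithLp.fstL 2 ℝ E E).hasFDerivAt).comp_hasDerivWithinAt t (hz t ht)

theorem IsTrajectory.hasDerivWithinAt_snd (hz : IsTrajectory (saddleField T g) 0 z) {t : ℝ}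
    (ht : 0 ≤ t) : HasDerivWithinAt (fun t => (z t).snd) (-T (z t).fst) (Ici 0) t :=
  ((WithLp.sndL 2 ℝ E E).hasFDerivAt).comp_hasDerivWithinAt t (hz t ht)

/-- The component of the dual variable in `ker T` is conserved. -/
theorem IsTrajectory.snd_sub_mem_ker_orthogonal (hT : T.IsSymmetric)
    (hz : IsTrajectory (saddleField T g) 0 z) {t : ℝ} (ht : 0 ≤ t) :
    (z t).snd - (z 0).snd ∈ (LinearMap.ker T)ᗮ := by
  rw [Submodule.mem_orthogonal]
  intro k hk
  have hd : ∀ s ∈ Icc 0 t, HasDerivWithinAt (fun s => ⟪k, (z s).snd⟫) 0 (Icc 0 t) s := by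
    intro s hs
    have h1 := (hasDerivWithinAt_const s (Icc 0 t) k).inner ℝ
      ((hz.hasDerivWithinAt_snd hs.1).mono Icc_subset_Ici_self)
    rw [inner_zero_left, add_zero, inner_neg_right, ← hT, LinearMap.mem_ker.1 hk, inner_zero_left,
      neg_zero] at h1
    exact h1
  have h2 := (convex_Icc 0 t).norm_image_sub_le_of_norm_hasDerivWithin_le (C := 0) hd
    (fun s _ => by simp) (left_mem_Icc.2 ht) (right_mem_Icc.2 ht)
  rw [zero_mul, norm_le_zero_iff] at h2
  rw [inner_sub_right]
  exact h2

theorem IsTrajectory.snd_sub_mem_ker_orthogonal_of_zero (hT : T.IsSymmetric)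
    (hz : IsTrajectory (saddleField T g) 0 z) {ν : E}
    (hν : (z 0).snd - ν ∈ (LinearMap.ker T)ᗮ) {t : ℝ} (ht : 0 ≤ t) :
    (z t).snd - ν ∈ (LinearMap.ker T)ᗮ := by
  have := add_mem (hz.snd_sub_mem_ker_orthogonal hT ht) hν
  rwa [sub_add_sub_cancel] at this

theorem tendsto_atTop_of_antitoneOn_Ici {φ : ℝ → ℝ} {a b : ℝ} (h : AntitoneOn φ (Ici a))
    (hb : ∀ t ∈ Ici a, b ≤ φ t) : ∃ l, Tendsto φ atTop (𝓝 l) := by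
  have hanti : Antitone fun t => φ (max a t) := fun s t hst =>
    h (mem_Ici.2 (le_max_left a s)) (mem_Ici.2 (le_max_left a t)) (max_le_max le_rfl hst)
  have hbdd : BddBelow (range fun t => φ (max a t)) :=
    ⟨b, by rintro _ ⟨t, rfl⟩; exact hb _ (mem_Ici.2 (le_max_left a t))⟩
  refine ⟨_, (tendsto_atTop_ciInf hanti hbdd).congr' ?_⟩
  filter_upwards [eventually_ge_atTop a] with t ht
  rw [max_eq_right ht]

variable [FiniteDimensional ℝ E]

/-- Convergence of the primal-dual dynamics to the equilibrium `(x̄, ν̄)`, when the monotone operator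
`g` is strictly monotone at `x̄`. -/
theorem IsTrajectory.tendsto_saddle (hT : T.IsSymmetric) (hgc : Continuous g)
    (hg : ∀ x y, 0 ≤ ⟪g x - g y, x - y⟫) {x' ν' : E} (hx' : T x' = 0) (hν' : g x' = T ν')
    (hpos : ∀ x, x ≠ x' → 0 < ⟪g x - g x', x - x'⟫)
    (hz : IsTrajectory (saddleField T g) 0 z) (h0 : (z 0).snd - ν' ∈ (LinearMap.ker T)ᗮ) :
    Tendsto (fun t => (z t).fst) atTop (𝓝 x') ∧ Tendsto (fun t => (z t).snd) atTop (𝓝 ν') := by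
  set F := saddleField T g with hF
  have hFc : Continuous F := continuous_saddleField hgc
  set z' : WithLp 2 (E × E) := WithLp.toLp 2 (x', ν') with hz'
  have hFz' : F z' = 0 := by
    have : F z' = WithLp.toLp 2 (-g x' + T ν', -T x') := rfl
    rw [this, hx', hν', neg_add_cancel, neg_zero]
    rfl
  have hinner : ∀ w, ⟪w - z', F w⟫ = -⟪g w.fst - g x', w.fst - x'⟫ := fun w => by
    have := inner_sub_saddleField_sub (g := g) hT w z'
    rw [← hF, hFz', sub_zero] at this
    exact this
  have hdist : AntitoneOn (fun t => ‖z t - z'‖) (Ici 0) := by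
    intro s hs t ht hst
    have := norm_le_add_mul_of_inner_deriv_le (u := fun t => z t - z') (u' := fun t => F (z t))
      (s := Ici 0) ordConnected_Ici (M := 0) hs ht hst
      (fun r hr => (hz r hr).sub_const z')
      (fun r _ => by
        simp only [hinner, zero_mul]
        linarith [hg (z r).fst x']) le_rfl
    simpa using this
  set K := Metric.closedBall z' ‖z 0 - z'‖ with hKdef
  have hK : IsCompact K := isCompact_closedBall _ _
  have hzK : MapsTo z (Ici 0) K := fun t ht => by
    rw [hKdef, Metric.mem_closedBall, dist_eq_norm]
    exact hdist self_mem_Ici ht ht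
  obtain ⟨B, hB⟩ := hK.exists_bound_of_continuousOn hFc.continuousOn
  have hzuc : UniformContinuousOn z (Ici 0) := by
    have hLip : LipschitzOnWith (Real.toNNReal B) z (Ici 0) := by
      refine (convex_Ici 0).lipschitzOnWith_of_nnnorm_hasDerivWithin_le hz fun t ht => ?_
      rw [← NNReal.coe_le_coe, coe_nnnorm]
      exact (hB _ (hzK ht)).trans (Real.le_coe_toNNReal B)
    exact hLip.uniformContinuousOn
  have hfstc : Continuous fun z : WithLp 2 (E × E) => z.fst := (WithLp.fstL 2 ℝ E E).continuous
  have hfst : Tendsto (fun t => (z t).fst) atTop (𝓝 x') := by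
    obtain ⟨l, hl⟩ := tendsto_atTop_of_antitoneOn_Ici (φ := fun t => ‖z t - z'‖ ^ 2) (b := 0)
      (fun s hs t ht hst => pow_le_pow_left₀ (norm_nonneg _) (hdist hs ht hst) 2)
      (fun t _ => sq_nonneg _)
    -- Confinement to the compact ball `K` makes this derivative uniformly continuous in time.
    have hW : Tendsto (fun t => 2 * ⟪z t - z', F (z t)⟫) atTop (𝓝 0) :=
      tendsto_deriv_zero_of_tendsto
        (fun t ht => ((hz t ht).sub_const z').norm_sq)
        ((hK.uniformContinuousOn_of_continuous (f := fun w => 2 * ⟪w - z', F w⟫)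
          (by fun_prop)).comp hzuc hzK) hl
    set W : E → ℝ := fun x => ⟪g x - g x', x - x'⟫ with hWdef
    have hWc : Continuous W := by fun_prop
    have hW0 : Tendsto (fun t => W (z t).fst) atTop (𝓝 0) := by
      have h1 := hW.const_mul (-1 / 2)
      simp only [hinner, mul_zero] at h1
      refine h1.congr fun t => ?_
      simp only [hWdef]; ring
    -- Every cluster point of the primal part is a zero of `W`, and `x'` is the only one.
    refine (hK.image hfstc).tendsto_nhds_of_unique_mapClusterPt ?_ ?_
    · filter_upwards [eventually_ge_atTop 0] with t ht
      exact mem_image_of_mem _ (hzK ht)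
    · intro y _ hy
      by_contra hne
      have h1 : MapClusterPt (W y) atTop (fun t => W (z t).fst) := hy.continuousAt_comp hWc.continuousAt
      have h2 : W y = 0 := by
        have h3 : ClusterPt (W y) (𝓝 0) := ClusterPt.mono h1 hW0
        exact t2_iff_nhds.1 inferInstance h3
      exact (hpos y hne).ne' h2
  refine ⟨hfst, ?_⟩
  have hv : Tendsto (fun t => -g (z t).fst + T (z t).snd) atTop (𝓝 0) :=
    tendsto_deriv_zero_of_tendsto (fun t ht => hz.hasDerivWithinAt_fst ht)
      ((hK.uniformContinuousOn_of_continuous (hfstc.comp hFc).continuousOn).comp hzuc hzK) hfst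
  have hTv : Tendsto (fun t => ‖T ((z t).snd - ν')‖) atTop (𝓝 0) := by
    have h1 := hv.add ((hgc.tendsto x').comp hfst)
    have h2 := (h1.sub_const (T ν')).norm
    rw [zero_add, hν', sub_self, norm_zero] at h2
    refine h2.congr fun t => ?_
    simp only [Function.comp_apply]
    rw [map_sub]
    congr 1
    abel
  obtain ⟨m, hm0, hm⟩ := hT.exists_pos_le_norm_apply
  rw [tendsto_iff_norm_sub_tendsto_zero]
  have h3 : Tendsto (fun t => m⁻¹ * ‖T ((z t).snd - ν')‖) atTop (𝓝 0) := by
    simpa using hTv.const_mul m⁻¹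
  refine squeeze_zero' (Eventually.of_forall fun t => norm_nonneg _) ?_ h3
  filter_upwards [eventually_ge_atTop 0] with t ht
  rw [le_inv_mul_iff₀ hm0]
  exact hm _ (hz.snd_sub_mem_ker_orthogonal_of_zero hT h0 ht)

end Trajectory

end SaddleFlow

/-! ### Exponential rate through a Lyapunov function with a cross term. -/

section SaddleRate

/-- The quadratic form bounding the decay of the Lyapunov function of the primal-dual dynamics is
nonnegative. -/
theorem saddle_quadratic_form_nonneg {lam2 lamN m ℓ a c p y : ℝ} (hN : 0 < lamN) (ha : 0 < a)
    (hm : a * (lamN ^ 2 + 3 / 4 * lamN * lam2 ^ 2 + ℓ ^ 2) ≤ m) (ha2 : (a * lam2) ^ 2 ≤ 1)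
    (hc : c * (lamN + 1) = 3 / 4 * a * lam2 ^ 2 * lamN) :
    0 ≤ (m - a * lamN ^ 2 - c) * p ^ 2 - a * (ℓ + 2 * c) * (p * y) +
      a * (1 - 3 / 4 * (lamN / (lamN + 1))) * y ^ 2 := by
  set k := 1 - 3 / 4 * (lamN / (lamN + 1)) with hk
  have hk4 : 4 * k * (lamN + 1) = lamN + 4 := by rw [hk]; field_simp; ring
  have hk0 : 0 < k := by
    by_contra! h
    nlinarith
  obtain ⟨e, he⟩ : ∃ e, c = a * e := ⟨c / a, by field_simp⟩
  have hee : e * (lamN + 1) = 3 / 4 * lam2 ^ 2 * lamN := by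
    have : a * (e * (lamN + 1)) = a * (3 / 4 * lam2 ^ 2 * lamN) := by rw [he] at hc; linarith
    exact mul_left_cancel₀ ha.ne' this
  have he0 : 0 ≤ e := by
    have : 0 ≤ e * (lamN + 1) := by rw [hee]; positivity
    exact nonneg_of_mul_nonneg_left this (by positivity)
  have hsq : (4 / 3) * (lamN + 1) * c ^ 2 ≤ lamN * e := by
    have h1 : (4 / 3) * (lamN + 1) * c ^ 2 = (a * lam2) ^ 2 * (lamN * e) := by
      rw [he]
      linear_combination (4 / 3) * a ^ 2 * e * hee
    rw [h1]
    exact mul_le_of_le_one_left (by positivity) ha2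
  -- After inserting `hsq`, the difference of the two sides is exactly one third of the square
  -- supplied here.
  have h2 : (lamN + 1) * (ℓ + 2 * c) ^ 2 ≤ (lamN + 4) * (lamN * e + ℓ ^ 2) := by
    nlinarith [sq_nonneg (3 * ℓ - 2 * (lamN + 1) * c),
      mul_le_mul_of_nonneg_left hsq (by positivity : 0 ≤ lamN + 4)]
  have h3 : (ℓ + 2 * c) ^ 2 ≤ 4 * k * (lamN * e + ℓ ^ 2) := by
    have : (lamN + 1) * (ℓ + 2 * c) ^ 2 ≤ (lamN + 1) * (4 * k * (lamN * e + ℓ ^ 2)) := by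
      calc _ ≤ _ := h2
        _ = _ := by rw [← hk4]; ring
    exact le_of_mul_le_mul_left this (by positivity)
  have h4 : a * (lamN * e + ℓ ^ 2) ≤ m - a * lamN ^ 2 - c := by
    have : a * (e * (lamN + 1)) = a * (3 / 4 * lam2 ^ 2 * lamN) := by rw [hee]
    rw [he]
    linarith
  -- This is the discriminant condition; completing the square then finishes.
  have h5 : a * (ℓ + 2 * c) ^ 2 ≤ 4 * k * (m - a * lamN ^ 2 - c) := by
    calc a * (ℓ + 2 * c) ^ 2 ≤ a * (4 * k * (lamN * e + ℓ ^ 2)) := by gcongr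
      _ = 4 * k * (a * (lamN * e + ℓ ^ 2)) := by ring
      _ ≤ _ := by gcongr
  have h6 : 0 ≤ 4 * k * ((m - a * lamN ^ 2 - c) * p ^ 2 - a * (ℓ + 2 * c) * (p * y) +
      a * k * y ^ 2) := by
    nlinarith [mul_le_mul_of_nonneg_right h5 (sq_nonneg p),
      mul_nonneg ha.le (sq_nonneg ((ℓ + 2 * c) * p - 2 * k * y))]
  exact nonneg_of_mul_nonneg_right h6 (by positivity)

variable {E : Type*} [NormedAddCommGroup E] [InnerProductSpace ℝ E]
  {T : E →ₗ[ℝ] E} {g : E → E} {z : ℝ → WithLp 2 (E × E)}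

/-- The cross term buys `-2a‖T v‖²` at the price of `2a‖T u‖²`, which strong monotonicity absorbs.
The fraction `3/4 · lamN / (lamN + 1)` of the gain pays for `c‖v‖²`; the rest enters a quadratic
form in `‖u‖` and `‖T v‖`. -/
theorem saddle_lyapunov_deriv_le (hT : T.IsSymmetric) {lam2 lamN m ℓ a c : ℝ} (hN : 0 < lamN)
    (h2 : 0 ≤ lam2) (hc0 : 0 ≤ c) (ha : 0 < a)
    (hm : a * (lamN ^ 2 + 3 / 4 * lamN * lam2 ^ 2 + ℓ ^ 2) ≤ m) (ha2 : (a * lam2) ^ 2 ≤ 1)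
    (hc : c * (lamN + 1) = 3 / 4 * a * lam2 ^ 2 * lamN) (hTN : ∀ x, ‖T x‖ ≤ lamN * ‖x‖)
    {u v d : E} (hdm : m * ‖u‖ ^ 2 ≤ ⟪d, u⟫) (hdℓ : ‖d‖ ≤ ℓ * ‖u‖) (hv : lam2 * ‖v‖ ≤ ‖T v‖) :
    2 * ⟪u, T v - d⟫ + 2 * ⟪v, -T u⟫ - 2 * a * (⟪u, T (-T u)⟫ + ⟪T v - d, T v⟫) ≤
      -(2 * c) * (‖u‖ ^ 2 + ‖v‖ ^ 2 - 2 * a * ⟪u, T v⟫) := by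
  have e2 : ⟪d, T v⟫ ≤ ℓ * (‖u‖ * ‖T v‖) := by
    refine (real_inner_le_norm _ _).trans ?_
    rw [← mul_assoc]
    exact mul_le_mul_of_nonneg_right hdℓ (norm_nonneg _)
  have e3 : ‖T u‖ ^ 2 ≤ lamN ^ 2 * ‖u‖ ^ 2 := by
    rw [← mul_pow]
    exact pow_le_pow_left₀ (norm_nonneg _) (hTN _) 2
  have e4 : lam2 ^ 2 * ‖v‖ ^ 2 ≤ ‖T v‖ ^ 2 := by
    rw [← mul_pow]
    exact pow_le_pow_left₀ (by positivity) hv 2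
  have e5 : -(‖u‖ * ‖T v‖) ≤ ⟪u, T v⟫ := neg_le_of_abs_le (abs_real_inner_le_norm _ _)
  have e6 : c * ‖v‖ ^ 2 ≤ 3 / 4 * a * (lamN / (lamN + 1)) * ‖T v‖ ^ 2 := by
    have : c = 3 / 4 * a * (lamN / (lamN + 1)) * lam2 ^ 2 := by
      field_simp
      linarith
    rw [this, mul_assoc]
    gcongr
  have hq := saddle_quadratic_form_nonneg (p := ‖u‖) (y := ‖T v‖) hN ha hm ha2 hc
  have e2' := mul_le_mul_of_nonneg_left e2 ha.le
  have e3' := mul_le_mul_of_nonneg_left e3 ha.le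
  have e5' := mul_le_mul_of_nonneg_left e5 (by positivity : 0 ≤ 2 * a * c)
  have heq : 2 * ⟪u, T v - d⟫ + 2 * ⟪v, -T u⟫ - 2 * a * (⟪u, T (-T u)⟫ + ⟪T v - d, T v⟫) =
      -2 * ⟪d, u⟫ + 2 * a * ⟪d, T v⟫ - 2 * a * ‖T v‖ ^ 2 + 2 * a * ‖T u‖ ^ 2 := by
    rw [map_neg, inner_neg_right, inner_neg_right, inner_sub_right, inner_sub_left,
      ← hT u (T u), ← hT v u, real_inner_self_eq_norm_sq, real_inner_self_eq_norm_sq,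
      real_inner_comm u (T v), real_inner_comm u d]
    ring
  rw [heq]
  linear_combination 2 * hdm + 2 * e2' + 2 * e3' + 2 * e5' + 2 * e6 + 2 * hq

/-- Exponential convergence of the primal-dual dynamics, through the Lyapunov function
`‖x - x̄‖² + ‖ν - ν̄‖² - 2 a ⟪x - x̄, T (ν - ν̄)⟫`. -/
theorem IsTrajectory.norm_sub_le_exp_saddle (hT : T.IsSymmetric) {x' ν' : E} (hx' : T x' = 0)
    (hν' : g x' = T ν') {lam2 lamN m ℓ ε : ℝ} (h2 : 0 < lam2) (h2N : lam2 ≤ lamN)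
    (hTN : ∀ x, ‖T x‖ ≤ lamN * ‖x‖) (hT2 : ∀ v ∈ (LinearMap.ker T)ᗮ, lam2 * ‖v‖ ≤ ‖T v‖)
    (hm0 : 0 < m) (hmℓ : m ≤ ℓ) (hgm : ∀ x, m * ‖x - x'‖ ^ 2 ≤ ⟪g x - g x', x - x'⟫)
    (hgℓ : ∀ x, ‖g x - g x'‖ ≤ ℓ * ‖x - x'‖) (hε0 : 0 < ε) (hε1 : ε < 1)
    (hz : IsTrajectory (saddleField T g) 0 z) (h0 : (z 0).snd - ν' ∈ (LinearMap.ker T)ᗮ)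
    {t : ℝ} (ht : 0 ≤ t) :
    ‖z t - WithLp.toLp 2 (x', ν')‖ ≤
      2 * Real.exp (-(3 * ε / 4 * (lamN * lam2 ^ 2 / (lamN + 1)) *
        (m / (lamN ^ 2 + 3 / 4 * lamN * lam2 ^ 2 + ℓ ^ 2))) * t) *
        ‖z 0 - WithLp.toLp 2 (x', ν')‖ := by
  have hN : 0 < lamN := h2.trans_le h2N
  have hℓ : 0 < ℓ := hm0.trans_le hmℓ
  set D := lamN ^ 2 + 3 / 4 * lamN * lam2 ^ 2 + ℓ ^ 2 with hD
  have hD0 : 0 < D := by positivity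
  set a := ε * m / D with ha
  have ha0 : 0 < a := by positivity
  set c := 3 * ε / 4 * (lamN * lam2 ^ 2 / (lamN + 1)) * (m / D) with hcdef
  have hc0 : 0 < c := by positivity
  have hc : c * (lamN + 1) = 3 / 4 * a * lam2 ^ 2 * lamN := by
    rw [hcdef, ha]; field_simp
  have haD : a * D = ε * m := by rw [ha]; field_simp
  have haD' : a * D ≤ m := by rw [haD]; nlinarith
  -- Here `m ≤ ℓ` enters: `D ≥ lamN² + m² ≥ 2 m lamN`. It keeps `V` between `1/2` and `3/2` of the
  -- squared distance.
  have haN : a * lamN ≤ 1 / 2 := by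
    have h1 : m * lamN * 2 ≤ D := by
      have : m ^ 2 ≤ ℓ ^ 2 := by gcongr
      have : 0 ≤ 3 / 4 * lamN * lam2 ^ 2 := by positivity
      nlinarith [sq_nonneg (m - lamN)]
    have h3 : a * lamN * D ≤ 1 / 2 * D := by
      calc a * lamN * D = ε * m * lamN := by rw [← haD]; ring
        _ ≤ 1 * m * lamN := by gcongr
        _ ≤ 1 / 2 * D := by linarith
    exact le_of_mul_le_mul_right h3 hD0
  have ha2 : (a * lam2) ^ 2 ≤ 1 := by
    have : a * lam2 ≤ 1 := (mul_le_mul_of_nonneg_left h2N ha0.le).trans (by linarith)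
    exact pow_le_one₀ (by positivity) this
  set u : ℝ → E := fun s => (z s).fst - x' with hu
  set v : ℝ → E := fun s => (z s).snd - ν' with hv
  have hnorm : ∀ s, ‖z s - WithLp.toLp 2 (x', ν')‖ ^ 2 = ‖u s‖ ^ 2 + ‖v s‖ ^ 2 := fun s =>
    WithLp.prod_norm_sq_eq_of_L2 _
  have hXle : ∀ s, |⟪u s, T (v s)⟫| ≤ lamN * (‖u s‖ * ‖v s‖) := fun s => by
    refine (abs_real_inner_le_norm _ _).trans ?_
    calc ‖u s‖ * ‖T (v s)‖ ≤ ‖u s‖ * (lamN * ‖v s‖) := by gcongr; exact hTN _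
      _ = _ := by ring
  set V : ℝ → ℝ := fun s => ‖u s‖ ^ 2 + ‖v s‖ ^ 2 - 2 * a * ⟪u s, T (v s)⟫ with hV
  have hcross : ∀ s, |2 * a * ⟪u s, T (v s)⟫| ≤ 1 / 2 * (‖u s‖ ^ 2 + ‖v s‖ ^ 2) := fun s => by
    rw [abs_mul, abs_of_pos (by positivity : 0 < 2 * a)]
    have h1 := mul_le_mul_of_nonneg_left (hXle s) (by positivity : 0 ≤ 2 * a)
    have h3 : 2 * a * (lamN * (‖u s‖ * ‖v s‖)) ≤ 2 * (1 / 2) * (‖u s‖ * ‖v s‖) := by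
      calc 2 * a * (lamN * (‖u s‖ * ‖v s‖)) = 2 * (a * lamN) * (‖u s‖ * ‖v s‖) := by ring
        _ ≤ _ := by gcongr
    nlinarith [sq_nonneg (‖u s‖ - ‖v s‖)]
  set gd : ℝ → E := fun s => g (z s).fst - g x' with hgd
  have hud : ∀ s ∈ Ici (0 : ℝ), HasDerivWithinAt u (T (v s) - gd s) (Ici 0) s := fun s hs => by
    have h1 := (hz.hasDerivWithinAt_fst hs).sub_const x'
    have h3 : -g (z s).fst + T (z s).snd = T (v s) - gd s := by
      simp only [hv, hgd, map_sub, hν']; abel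
    rwa [h3] at h1
  have hvd : ∀ s ∈ Ici (0 : ℝ), HasDerivWithinAt v (-T (u s)) (Ici 0) s := fun s hs => by
    have h1 := (hz.hasDerivWithinAt_snd hs).sub_const ν'
    have h3 : T (z s).fst = T (u s) := by simp only [hu, map_sub, hx', sub_zero]
    rwa [h3] at h1
  have hTvd : ∀ s ∈ Ici (0 : ℝ), HasDerivWithinAt (fun s => T (v s)) (T (-T (u s))) (Ici 0) s :=
    fun s hs => ((T.mkContinuous lamN hTN).hasFDerivAt).comp_hasDerivWithinAt s (hvd s hs)
  set V' : ℝ → ℝ := fun s => 2 * ⟪u s, T (v s) - gd s⟫ + 2 * ⟪v s, -T (u s)⟫ -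
    2 * a * (⟪u s, T (-T (u s))⟫ + ⟪T (v s) - gd s, T (v s)⟫) with hV'
  have hVd : ∀ s ∈ Ici (0 : ℝ), HasDerivWithinAt V (V' s) (Ici 0) s := fun s hs =>
    (((hud s hs).norm_sq).add ((hvd s hs).norm_sq)).sub
      (((hud s hs).inner ℝ (hTvd s hs)).const_mul (2 * a))
  have hdecay : ∀ s ∈ Ici (0 : ℝ), V' s ≤ -(2 * c) * V s := fun s hs =>
    saddle_lyapunov_deriv_le hT hN h2.le hc0.le ha0 haD' ha2 hc hTN (hgm _) (hgℓ _)
      (hT2 _ (hz.snd_sub_mem_ker_orthogonal_of_zero hT h0 hs))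
  have hanti : AntitoneOn (fun s => V s * Real.exp (2 * c * s)) (Ici 0) := by
    have hd : ∀ s ∈ Ici (0 : ℝ), HasDerivWithinAt (fun s => V s * Real.exp (2 * c * s))
        (V' s * Real.exp (2 * c * s) + V s * (Real.exp (2 * c * s) * (2 * c))) (Ici 0) s := by
      intro s hs
      have h1 : HasDerivAt (fun s => Real.exp (2 * c * s)) (Real.exp (2 * c * s) * (2 * c)) s := by
        have := ((hasDerivAt_id s).const_mul (2 * c)).exp
        rwa [mul_one] at this
      exact (hVd s hs).mul h1.hasDerivWithinAt
    refine antitoneOn_of_hasDerivWithinAt_nonpos (convex_Ici 0)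
      (fun s hs => (hd s hs).continuousWithinAt)
      (fun s hs => (hd s (interior_subset hs)).mono interior_subset) fun s hs => ?_
    have h1 := mul_le_mul_of_nonneg_right (hdecay s (interior_subset hs))
      (Real.exp_pos (2 * c * s)).le
    linarith
  have hVt : V t * Real.exp (2 * c * t) ≤ V 0 := by
    simpa using hanti self_mem_Ici (show t ∈ Ici (0 : ℝ) from ht) ht
  have hup : V 0 ≤ 3 / 2 * ‖z 0 - WithLp.toLp 2 (x', ν')‖ ^ 2 := by
    rw [hnorm]
    have := neg_le_of_abs_le (hcross 0)
    simp only [hV]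
    linarith
  have hlow : 1 / 2 * ‖z t - WithLp.toLp 2 (x', ν')‖ ^ 2 ≤ V t := by
    rw [hnorm]
    have := le_of_abs_le (hcross t)
    simp only [hV]
    linarith
  refine le_of_sq_le_sq ?_ (by positivity)
  have hexp : Real.exp (-c * t) ^ 2 * Real.exp (2 * c * t) = 1 := by
    rw [← Real.exp_nat_mul, ← Real.exp_add]
    norm_num
    ring
  have h3 : 1 / 2 * ‖z t - WithLp.toLp 2 (x', ν')‖ ^ 2 * Real.exp (2 * c * t) ≤
      3 / 2 * ‖z 0 - WithLp.toLp 2 (x', ν')‖ ^ 2 :=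
    (mul_le_mul_of_nonneg_right hlow (Real.exp_pos _).le).trans (hVt.trans hup)
  refine le_of_mul_le_mul_right ?_ (Real.exp_pos (2 * c * t))
  have h4 : (2 * Real.exp (-c * t) * ‖z 0 - WithLp.toLp 2 (x', ν')‖) ^ 2 * Real.exp (2 * c * t) =
      4 * ‖z 0 - WithLp.toLp 2 (x', ν')‖ ^ 2 := by
    linear_combination 4 * ‖z 0 - WithLp.toLp 2 (x', ν')‖ ^ 2 * hexp
  rw [h4]
  -- The ratio of the two comparison constants is `3 ≤ 2²`, hence the overshoot `2`.
  nlinarith [sq_nonneg ‖z 0 - WithLp.toLp 2 (x', ν')‖]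

end SaddleRate

/-! ### The distributed dynamics as a saddle flow. -/

section DistributedPrimalDual

variable {N n : ℕ}

/-- The stacked gradient `(∇f₁(x¹), …, ∇f_N(xᴺ))`. -/
noncomputable def blockGradient (f : Fin N → EuclideanSpace ℝ (Fin n) → ℝ) (x : AgentVec N n) :
    AgentVec N n :=
  WithLp.toLp 2 fun i => gradient (f i) (x i)

theorem distributedPD_eq_saddleField (G : SimpleGraph (Fin N)) [DecidableRel G.Adj]
    (f : Fin N → EuclideanSpace ℝ (Fin n) → ℝ) :
    distributedPD G f = saddleField (blockLaplacian G) (blockGradient f) := by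
  funext z
  have h1 : (WithLp.toLp 2 fun i => -gradient (f i) (z.fst i) -
      ∑ j ∈ G.neighborFinset i, (z.snd j - z.snd i) : AgentVec N n) =
      -blockGradient f z.fst + blockLaplacian G z.snd := by
    ext i : 1
    rw [PiLp.add_apply, PiLp.neg_apply, blockLaplacian_apply, PiLp.toLp_apply, sub_eq_add_neg,
      ← Finset.sum_neg_distrib]
    simp only [neg_sub]
    rfl
  have h2 : (WithLp.toLp 2 fun i => ∑ j ∈ G.neighborFinset i, (z.fst j - z.fst i) :
      AgentVec N n) = -blockLaplacian G z.fst := by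
    ext i : 1
    rw [PiLp.neg_apply, blockLaplacian_apply, PiLp.toLp_apply, ← Finset.sum_neg_distrib]
    simp only [neg_sub]
  simp only [distributedPD, mkPDState, saddleField, h1, h2]

variable {f : Fin N → EuclideanSpace ℝ (Fin n) → ℝ}

theorem continuous_blockGradient (hf : ∀ i, Continuous (gradient (f i))) :
    Continuous (blockGradient f) :=
  (PiLp.continuous_toLp 2 _).comp (continuous_pi fun i =>
    (hf i).comp ((continuous_apply i).comp (PiLp.continuous_ofLp 2 _)))

theorem inner_blockGradient_sub (x y : AgentVec N n) :
    ⟪blockGradient f x - blockGradient f y, x - y⟫ =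
      ∑ i, ⟪gradient (f i) (x i) - gradient (f i) (y i), x i - y i⟫ := rfl

theorem inner_blockGradient_sub_nonneg (hconv : ∀ i, ConvexOn ℝ univ (f i))
    (hd : ∀ i, Differentiable ℝ (f i)) (x y : AgentVec N n) :
    0 ≤ ⟪blockGradient f x - blockGradient f y, x - y⟫ := by
  rw [inner_blockGradient_sub]
  exact Finset.sum_nonneg fun i _ => (hconv i).inner_gradient_sub_nonneg (hd i) _ _

variable {G : SimpleGraph (Fin N)} [DecidableRel G.Adj] {xstar : EuclideanSpace ℝ (Fin n)}

/-- At a minimizer of `∑ fᵢ` there is a dual equilibrium with prescribed sum. -/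
theorem exists_dual_equilibrium (hG : G.Connected) (hd : ∀ i, Differentiable ℝ (f i))
    (hmin : IsMinOn (fun x => ∑ i, f i x) univ xstar) (σ : EuclideanSpace ℝ (Fin n)) :
    ∃ ν : AgentVec N n, blockGradient f (WithLp.toLp 2 fun _ => xstar) = blockLaplacian G ν ∧
      ∑ i, ν i = σ := by
  have hmem : blockGradient f (WithLp.toLp 2 fun _ => xstar) ∈
      LinearMap.range (blockLaplacian (n := n) G) := by
    rw [(isSymmetric_blockLaplacian G).range_eq_ker_orthogonal,
      mem_ker_blockLaplacian_orthogonal_iff hG]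
    exact sum_gradient_eq_zero_of_isMinOn hd hmin
  obtain ⟨ν, hν⟩ := hmem
  have hN : (N : ℝ) ≠ 0 := by
    obtain ⟨i⟩ := hG.nonempty
    exact_mod_cast i.pos.ne'
  -- Consensus shifts lie in the kernel, so they adjust the sum freely.
  refine ⟨ν + WithLp.toLp 2 fun _ => (N : ℝ)⁻¹ • (σ - ∑ i, ν i), ?_, ?_⟩
  · rw [map_add, hν, (blockLaplacian_eq_zero_iff hG).2 fun _ _ => rfl, add_zero]
  · simp only [PiLp.add_apply, Finset.sum_add_distrib, Finset.sum_const, Finset.card_univ,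
      Fintype.card_fin]
    rw [← Nat.cast_smul_eq_nsmul ℝ, smul_smul, mul_inv_cancel₀ hN, one_smul]
    abel

theorem sum_snd_eq (hG : G.Connected) {z : ℝ → PDState N n}
    (hz : IsTrajectory (saddleField (blockLaplacian G) (blockGradient f)) 0 z) {t : ℝ}
    (ht : 0 ≤ t) : ∑ k, (z t).snd k = ∑ k, (z 0).snd k := by
  have h := (mem_ker_blockLaplacian_orthogonal_iff hG).1
    (hz.snd_sub_mem_ker_orthogonal (isSymmetric_blockLaplacian G) ht)
  simpa [sub_eq_zero] using h

theorem tendsto_of_strictMono_gradient (hG : G.Connected) (hconv : ∀ i, ConvexOn ℝ univ (f i))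
    (hdiff : ∀ i, TwiceDifferentiable (f i))
    (hpos : ∀ i, ∀ x ≠ xstar, 0 < ⟪gradient (f i) x - gradient (f i) xstar, x - xstar⟫)
    {ν : AgentVec N n}
    (hν : blockGradient f (WithLp.toLp 2 fun _ => xstar) = blockLaplacian G ν)
    {z : ℝ → PDState N n} (hz : IsTrajectory (saddleField (blockLaplacian G) (blockGradient f)) 0 z)
    (hsum : ∑ k, ν k = ∑ k, (z 0).snd k) :
    Tendsto (fun t => (z t).fst) atTop (𝓝 (WithLp.toLp 2 fun _ => xstar)) ∧
      Tendsto (fun t => (z t).snd) atTop (𝓝 ν) := by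
  have hd : ∀ i, Differentiable ℝ (f i) := fun i => (hdiff i).1
  refine hz.tendsto_saddle (isSymmetric_blockLaplacian G)
    (continuous_blockGradient fun i => (hdiff i).2.continuous)
    (inner_blockGradient_sub_nonneg hconv hd)
    ((blockLaplacian_eq_zero_iff hG).2 fun _ _ => rfl) hν (fun x hx => ?_) ?_
  · rw [inner_blockGradient_sub]
    obtain ⟨i, hi⟩ : ∃ i, x i ≠ xstar := by
      by_contra! hall
      exact hx (by ext i : 1; exact hall i)
    exact Finset.sum_pos' (fun j _ => (hconv j).inner_gradient_sub_nonneg (hd j) _ _)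
      ⟨i, Finset.mem_univ i, hpos i _ hi⟩
  · rw [mem_ker_blockLaplacian_orthogonal_iff hG]
    simp [hsum]

theorem pdConverges_of_strictMono_gradient (hG : G.Connected)
    (hconv : ∀ i, ConvexOn ℝ univ (f i)) (hdiff : ∀ i, TwiceDifferentiable (f i))
    (hmin : IsMinOn (fun x => ∑ i, f i x) univ xstar)
    (hpos : ∀ i, ∀ x ≠ xstar, 0 < ⟪gradient (f i) x - gradient (f i) xstar, x - xstar⟫) :
    PDConverges G f xstar := by
  intro z hz
  rw [distributedPD_eq_saddleField] at hz
  obtain ⟨ν, hν, hsum⟩ := exists_dual_equilibrium hG (fun i => (hdiff i).1) hmin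
    (∑ k, (z 0).snd k)
  obtain ⟨h1, h2⟩ := tendsto_of_strictMono_gradient hG hconv hdiff hpos hν hz hsum
  have happly : ∀ i, Continuous fun x : AgentVec N n => x i := fun i =>
    (continuous_apply i).comp (PiLp.continuous_ofLp 2 _)
  exact ⟨fun i => ((happly i).tendsto _).comp h1, fun t ht => sum_snd_eq hG hz ht, ν,
    fun i => ((happly i).tendsto _).comp h2, hsum⟩

theorem inner_gradient_sub_pos_of_hessianPosDef {f : EuclideanSpace ℝ (Fin n) → ℝ}
    (hconv : ConvexOn ℝ univ f) (hdiff : TwiceDifferentiable f) (hH : HessianPosDef f xstar)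
    {x : EuclideanSpace ℝ (Fin n)} (hx : x ≠ xstar) :
    0 < ⟪gradient f x - gradient f xstar, x - xstar⟫ :=
  hconv.inner_gradient_sub_pos hdiff.1 (hdiff.2 xstar) (hH _ (sub_ne_zero.2 hx))

theorem StronglyConvexWithConst.inner_gradient_sub_pos {K : ℝ}
    {f : EuclideanSpace ℝ (Fin n) → ℝ} (hf : StronglyConvexWithConst K f)
    {x : EuclideanSpace ℝ (Fin n)} (hx : x ≠ xstar) :
    0 < ⟪gradient f x - gradient f xstar, x - xstar⟫ :=
  (mul_pos hf.1 (pow_pos (norm_pos_iff.2 (sub_ne_zero.2 hx)) 2)).trans_le (hf.2 x xstar)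

theorem StronglyConvexWithConst.le_lipschitz [NeZero n] {K L : ℝ}
    {f : EuclideanSpace ℝ (Fin n) → ℝ} (hK : StronglyConvexWithConst K f)
    (hL : LipschitzSmoothWithConst L f) : K ≤ L := by
  obtain ⟨x, hx⟩ := exists_ne (0 : EuclideanSpace ℝ (Fin n))
  have hpos : 0 < ‖x - 0‖ := norm_pos_iff.2 (sub_ne_zero.2 hx)
  have h1 := (hK.2 x 0).trans (real_inner_le_norm _ _)
  have h2 := mul_le_mul_of_nonneg_right (hL.2 x 0) hpos.le
  refine le_of_mul_le_mul_right (a := ‖x - 0‖ ^ 2) ?_ (by positivity)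
  calc K * ‖x - 0‖ ^ 2 ≤ _ := h1
    _ ≤ _ := h2
    _ = L * ‖x - 0‖ ^ 2 := by ring

theorem mul_norm_sq_le_inner_blockGradient_sub {ℓinf : Fin N → ℝ}
    (hs : ∀ i, StronglyConvexWithConst (ℓinf i) (f i)) (x y : AgentVec N n) :
    (⨅ i, ℓinf i) * ‖x - y‖ ^ 2 ≤ ⟪blockGradient f x - blockGradient f y, x - y⟫ := by
  rw [inner_blockGradient_sub, PiLp.norm_sq_eq_of_L2, Finset.mul_sum]
  refine Finset.sum_le_sum fun i _ => le_trans ?_ ((hs i).2 (x i) (y i))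
  exact mul_le_mul_of_nonneg_right (ciInf_le (finite_range ℓinf).bddBelow i) (sq_nonneg _)

theorem norm_blockGradient_sub_le {ℓsup : Fin N → ℝ}
    (hl : ∀ i, LipschitzSmoothWithConst (ℓsup i) (f i)) (x y : AgentVec N n) :
    ‖blockGradient f x - blockGradient f y‖ ≤ ‖ℓsup‖ * ‖x - y‖ := by
  refine le_of_sq_le_sq ?_ (by positivity)
  rw [mul_pow, PiLp.norm_sq_eq_of_L2, PiLp.norm_sq_eq_of_L2, Finset.mul_sum]
  refine Finset.sum_le_sum fun i _ => ?_
  rw [← mul_pow]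
  refine pow_le_pow_left₀ (norm_nonneg _) (((hl i).2 (x i) (y i)).trans ?_) 2
  exact mul_le_mul_of_nonneg_right ((le_abs_self _).trans (norm_le_pi_norm ℓsup i)) (norm_nonneg _)

theorem pdConvergesWithRate_of_stronglyConvex (hG : G.Connected)
    (hconv : ∀ i, ConvexOn ℝ univ (f i)) (hdiff : ∀ i, TwiceDifferentiable (f i))
    (hmin : IsMinOn (fun x => ∑ i, f i x) univ xstar) {ℓinf ℓsup : Fin N → ℝ}
    (hs : ∀ i, StronglyConvexWithConst (ℓinf i) (f i))
    (hl : ∀ i, LipschitzSmoothWithConst (ℓsup i) (f i)) {lam2 lamN : ℝ}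
    (h2 : IsLeast {μ : ℝ | μ ≠ 0 ∧ IsLaplacianEigenvalue G μ} lam2)
    (hN : IsGreatest {μ : ℝ | IsLaplacianEigenvalue G μ} lamN) {ε : ℝ} (hε0 : 0 < ε)
    (hε1 : ε < 1) :
    PDConvergesWithRate G f xstar
      (3 * ε / 4 * (lamN * lam2 ^ 2 / (lamN + 1)) *
        ((⨅ i, ℓinf i) / (lamN ^ 2 + 3 / 4 * lamN * lam2 ^ 2 + ‖ℓsup‖ ^ 2))) := by
  refine ⟨2, two_pos, fun z hz => ?_⟩
  rw [distributedPD_eq_saddleField] at hz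
  obtain ⟨ν, hν, hsum⟩ := exists_dual_equilibrium hG (fun i => (hdiff i).1) hmin
    (∑ k, (z 0).snd k)
  obtain ⟨hx, hνt⟩ := tendsto_of_strictMono_gradient hG hconv hdiff
    (fun i x hx => (hs i).inner_gradient_sub_pos hx) hν hz hsum
  refine ⟨ν, hsum, ?_, fun t ht => ?_⟩
  · exact ((WithLp.prod_continuous_toLp 2 (AgentVec N n) (AgentVec N n)).tendsto _).comp
      (hx.prodMk_nhds hνt)
  -- For `n = 0` the constants need not satisfy `m ≤ ℓ`, but the state space is a point.
  · rcases Nat.eq_zero_or_pos n with rfl | hn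
    · have hsub : ∀ w : PDState N 0, w = 0 := fun w => by
        have : ∀ x : AgentVec N 0, x = 0 := fun x => by ext i k; exact k.elim0
        exact (WithLp.ofLp_injective 2) (Prod.ext (this _) (this _))
      rw [hsub (z t - _), norm_zero]
      positivity
    · have : NeZero n := ⟨hn.ne'⟩
      have : Nonempty (Fin N) := hG.nonempty
      have hlam2 : 0 < lam2 := lt_of_le_of_ne (IsLaplacianEigenvalue.nonneg h2.1.2) h2.1.1.symm
      obtain ⟨i, hi⟩ := exists_eq_ciInf_of_finite (f := ℓinf)
      refine hz.norm_sub_le_exp_saddle (isSymmetric_blockLaplacian G)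
        ((blockLaplacian_eq_zero_iff hG).2 fun _ _ => rfl) hν hlam2 (hN.2 h2.1.2)
        (fun x => (isSymmetric_blockLaplacian G).norm_apply_le
          (IsLaplacianEigenvalue.nonneg hN.1) (fun μ hμ => ?_) x)
        (fun v hv => (isSymmetric_blockLaplacian G).le_norm_apply_of_mem_ker_orthogonal
          hlam2.le (fun μ hμ0 hμ => ?_) hv) ?_ ?_
        (fun x => mul_norm_sq_le_inner_blockGradient_sub hs x _)
        (fun x => norm_blockGradient_sub_le hl x _) hε0 hε1 ?_ ht
      · have hμ' := isLaplacianEigenvalue_of_blockLaplacian hμ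
        rw [abs_of_nonneg hμ'.nonneg]
        exact hN.2 hμ'
      · exact (h2.2 ⟨hμ0, isLaplacianEigenvalue_of_blockLaplacian hμ⟩).trans (le_abs_self μ)
      · rw [← hi]
        exact (hs i).1
      · rw [← hi]
        exact ((hs i).le_lipschitz (hl i)).trans
          ((le_abs_self _).trans (norm_le_pi_norm ℓsup i))
      · rw [mem_ker_blockLaplacian_orthogonal_iff hG]
        simp [hsum]

end DistributedPrimalDual

/-- Connectedness gives `N ≥ 1`, and the existence of a nonzero Laplacian eigenvalue encodes `N ≥
2`. The norm `‖ℓsup‖` is the sup norm on `Fin N → ℝ`. -/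
theorem theorem3 {N n : ℕ} (G : SimpleGraph (Fin N)) [DecidableRel G.Adj] (hG : G.Connected)
    (f : Fin N → EuclideanSpace ℝ (Fin n) → ℝ)
    (hconv : ∀ i, ConvexOn ℝ Set.univ (f i))
    (hdiff : ∀ i, TwiceDifferentiable (f i)) :
    WeaklyContractive (distributedPD G f) ∧
    (∀ xstar : EuclideanSpace ℝ (Fin n),
      IsMinOn (fun x => ∑ i, f i x) Set.univ xstar →
      (∀ i, HessianPosDef (f i) xstar) →
      PDConverges G f xstar) ∧
    (∀ (xstar : EuclideanSpace ℝ (Fin n)) (ℓinf ℓsup : Fin N → ℝ),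
      IsMinOn (fun x => ∑ i, f i x) Set.univ xstar →
      (∀ i, StronglyConvexWithConst (ℓinf i) (f i)) →
      (∀ i, LipschitzSmoothWithConst (ℓsup i) (f i)) →
      PDConverges G f xstar ∧
      ∀ lam2 lamN : ℝ,
        IsLeast {μ : ℝ | μ ≠ 0 ∧ IsLaplacianEigenvalue G μ} lam2 →
        IsGreatest {μ : ℝ | IsLaplacianEigenvalue G μ} lamN →
        ∀ ε : ℝ, 0 < ε → ε < 1 →
          PDConvergesWithRate G f xstar
            (3 * ε / 4 * (lamN * lam2 ^ 2 / (lamN + 1)) *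
              ((⨅ i, ℓinf i) / (lamN ^ 2 + 3 / 4 * lamN * lam2 ^ 2 + ‖ℓsup‖ ^ 2)))) := by
  refine ⟨?_, fun xstar hmin hH => ?_, fun xstar ℓinf ℓsup hmin hs hl => ⟨?_, ?_⟩⟩
  · rw [distributedPD_eq_saddleField]
    exact weaklyContractive_of_dissipative
      (continuous_saddleField (continuous_blockGradient fun i => (hdiff i).2.continuous))
      (saddleField_dissipative (isSymmetric_blockLaplacian G)
        (inner_blockGradient_sub_nonneg hconv fun i => (hdiff i).1))
  · exact pdConverges_of_strictMono_gradient hG hconv hdiff hmin fun i x hx =>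
      inner_gradient_sub_pos_of_hessianPosDef (hconv i) (hdiff i) (hH i) hx
  · exact pdConverges_of_strictMono_gradient hG hconv hdiff hmin fun i x hx =>
      (hs i).inner_gradient_sub_pos hx
  · exact fun lam2 lamN h2 hN ε hε0 hε1 =>
      pdConvergesWithRate_of_stronglyConvex hG hconv hdiff hmin hs hl h2 hN hε0 hε1
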